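/- Let $M$ be the matroid of the Hilbert--Cohn-Vossen configuration $(9_3)_2$: its ground set is $[9]=\{1,\dots,9\}$, and a subset is independent if and only if it has at most three elements and is not one of the nine lines $$\{1,2,5\},\{1,3,4\},\{1,7,9\},\{2,6,9\},\{2,7,8\},\{3,5,9\},\{3,6,8\},\{4,5,8\},\{4,6,7\}.$$ Let $R$ be a nonzero commutative ring, let $E$ be the exterior algebra over $R$ of the free module with basis $e_1,\dots,e_9$, and let $\partial$ be the $R$-linear map $E\to E$ of degree $-1$ with $\partial e_i=1$ and $\partial(ab)=(\partial a)b+(-1)^{\deg a}a\,\partial b$ for homogeneous $a$. Let $e_S=e_{i_1}\cdots e_{i_p}$ for $S=\{i_1<\dots<i_p\}\subseteq[9]$. Let $I$ be the Orlik--Solomon ideal of $M$, i.e. the ideal of $E$ generated by $\partial e_S$ for all dependent sets $S$ of $M$, and let $J$ be the ideal generated by the homogeneous components $I_r$ of $I$ with $r\le 2$. The Orlik--Solomon algebra $E/I$ is called quadratic if $J=I$. Let $J^0=\{a\in E: ab=0\text{ for all }b\in J\}$ be the annihilator of $J$. An element of $E$ is pure if it is a product of elements of degree $1$, and an ideal is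 pure if it is generated by pure elements. A partition of $[9]$ is $p$-independent if choosing one element from each of at most $p$ of its parts always yields an independent set of $M$; it is independent if it is $(\ell+1)$-independent, where $\ell$ is the rank of $M$. The matroid $M$ is $3$-independent if every $3$-independent partition of $[9]$ is independent. Then the following hold. 1. $M$ has rank $3$ and is $3$-independent. 2. The Orlik--Solomon algebra $E/I$ is not quadratic, i.e. $J\neq I$. More precisely, $J_3$ has rank at most $63$ over $R$, while $I_3$ is a free $R$-module of rank $65$. 3. Let $\tau$ be the permutation of $[9]$ sending $1,2,\dots,9$ to $2,6,1,5,9,4,8,3,7$ respectively, acting on $E$ by the algebra automorphism $e_i\mapsto e_{\tau(i)}$. Put $$x=e_1e_2e_3e_6e_8-e_1e_2e_4e_6e_9+e_1e_2e_4e_8e_9-e_1e_2e_6e_8e_9-e_2e_3e_5e_6e_9,$$ $p=(1-\tau)(1+\tau^3+\tau^6)x$ and $q=\tau p$. Then $p$ and $q$ form a basis of the $R$-module $(J^0)_5$. 4. If $R$ is an integral domain (for instance a field), then $(J^0)_5$ contains no nonzero pure element, and the ideal $J^0$ is not pure. In particular, $3$-independence of a matroid does not imply that its Orlik--Solomon algebra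 is quadratic. -/

import Mathlib

noncomputable section

namespace OrlikSolomon

/-! ### The exterior algebra on `e_1, …, e_n` and its differential -/

/-- The exterior algebra `E` of the free module `R^n`, the generators being indexed by `Fin n`. -/
abbrev Ext (R : Type*) [CommRing R] (n : ℕ) : Type _ := ExteriorAlgebra R (Fin n → R)

variable (R : Type*) [CommRing R]

/-- The generator of `E` indexed by `i`. -/
def gen {n : ℕ} (i : Fin n) : Ext R n := ExteriorAlgebra.ι R (Pi.single i 1)

/-- The monomial `e_S`: the product of the `e_i`, `i ∈ S`, in increasing order. -/
def mono {n : ℕ} (S : Finset (Fin n)) : Ext R n := (S.sort.map (gen R)).prod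

/-- The differential `∂`, i.e. the left contraction with the linear form sending each `e_i` to `1`;
see `differential_one`, `differential_gen`, `differential_gen_mul`. -/
def differential (n : ℕ) : Ext R n →ₗ[R] Ext R n :=
  CliffordAlgebra.contractLeft (Q := (0 : QuadraticForm R (Fin n → R)))
    (∑ i : Fin n, LinearMap.proj i)

theorem differential_one (n : ℕ) : differential R n 1 = 0 :=
  CliffordAlgebra.contractLeft_one _ _

theorem differential_gen_mul {n : ℕ} (i : Fin n) (b : Ext R n) :
    differential R n (gen R i * b) = b - gen R i * differential R n b := by
  refine (CliffordAlgebra.contractLeft_ι_mul _ _ _).trans ?_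
  simp [gen, differential, ExteriorAlgebra.ι]

theorem differential_gen {n : ℕ} (i : Fin n) : differential R n (gen R i) = 1 := by
  have h := differential_gen_mul R i 1
  simpa [differential_one] using h

/-- The homogeneous component `I_p = I ∩ E_p` of a two-sided ideal `I` of `E`. -/
def component {n : ℕ} (I : TwoSidedIdeal (Ext R n)) (p : ℕ) : Submodule R (Ext R n) :=
  (TwoSidedIdeal.asIdeal I).restrictScalars R ⊓ ⋀[R]^p (Fin n → R)

/-! ### Orlik–Solomon ideals, the ideals `J(p, M)`, annihilators, pure ideals -/

/-- The Orlik–Solomon ideal `I(M)`, generated by `∂ e_S` for the dependent sets `S` of `M`. -/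
def osIdeal {n : ℕ} (M : Matroid (Fin n)) : TwoSidedIdeal (Ext R n) :=
  TwoSidedIdeal.span {a | ∃ S : Finset (Fin n), M.Dep (S : Set (Fin n)) ∧
    a = differential R n (mono R S)}

/-- `J(p, M)`, the ideal generated by the components `I_r(M)` with `r ≤ p`. -/
def truncIdeal {n : ℕ} (p : ℕ) (M : Matroid (Fin n)) : TwoSidedIdeal (Ext R n) :=
  TwoSidedIdeal.span {a | ∃ r ≤ p, a ∈ component R (osIdeal R M) r}

/-- The Orlik–Solomon algebra `E / I(M)` is quadratic: `I(M)` is generated in degree two. -/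
def IsQuadratic {n : ℕ} (M : Matroid (Fin n)) : Prop := truncIdeal R 2 M = osIdeal R M

/-- The annihilator `I⁰ = {a ∈ E | a b = 0 for all b ∈ I}`. -/
def annihilator {n : ℕ} (I : TwoSidedIdeal (Ext R n)) : TwoSidedIdeal (Ext R n) :=
  TwoSidedIdeal.mk' {a | ∀ b ∈ I, a * b = 0}
    (fun b _ => zero_mul b)
    (fun {x y} hx hy b hb => by rw [add_mul, hx b hb, hy b hb, add_zero])
    (fun {x} hx b hb => by rw [neg_mul, hx b hb, neg_zero])
    (fun {x y} hy b hb => by rw [mul_assoc, hy b hb, mul_zero])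
    (fun {x y} hx b hb => by rw [mul_assoc, hx _ (I.mul_mem_left y b hb)])

theorem mem_annihilator {n : ℕ} (I : TwoSidedIdeal (Ext R n)) (a : Ext R n) :
    a ∈ annihilator R I ↔ ∀ b ∈ I, a * b = 0 :=
  TwoSidedIdeal.mem_mk' _ _ _ _ _ _ _

/-- A pure (decomposable) element: a product of elements of degree one. -/
def IsPure {n : ℕ} (a : Ext R n) : Prop :=
  ∃ l : List (Fin n → R), a = (l.map (ExteriorAlgebra.ι R)).prod

/-- A pure ideal: an ideal generated by a set of pure elements. -/
def IsPureIdeal {n : ℕ} (I : TwoSidedIdeal (Ext R n)) : Prop :=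
  ∃ S : Set (Ext R n), (∀ a ∈ S, IsPure R a) ∧ I = TwoSidedIdeal.span S

/-! ### `p`-independence -/

/-- A partition of `[n]` is `p`-independent if choosing one element from each of at most `p` of
its parts always gives an independent set of `M`. -/
def PartitionIndep {n : ℕ} (M : Matroid (Fin n)) (p : ℕ∞)
    (π : Finpartition (Finset.univ : Finset (Fin n))) : Prop :=
  ∀ 𝒜 : Finset (Finset (Fin n)), 𝒜 ⊆ π.parts → (𝒜.card : ℕ∞) ≤ p →
    ∀ c : Finset (Fin n) → Fin n, (∀ A ∈ 𝒜, c A ∈ A) →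
      M.Indep (c '' (𝒜 : Set (Finset (Fin n))))

/-- `M` is `p`-independent if every `p`-independent partition is independent, i.e.
`(ℓ + 1)`-independent, where `ℓ` is the rank of `M`. -/
def MatroidIndep {n : ℕ} (M : Matroid (Fin n)) (p : ℕ∞) : Prop :=
  ∀ π : Finpartition (Finset.univ : Finset (Fin n)),
    PartitionIndep M p π → PartitionIndep M (M.eRank + 1) π

/-! ### The Hilbert–Cohn-Vossen configuration `(9_3)_2` -/

/-- The point with label `k ∈ {1, …, 9}`, i.e. the element `k - 1` of `Fin 9`. -/
def pt (k : ℕ) : Fin 9 := Fin.ofNat 9 (k + 8)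

/-- The nine lines of the configuration, on points labelled `1, …, 9`. -/
def hcvLines : Finset (Finset (Fin 9)) :=
  {{pt 1, pt 2, pt 5}, {pt 1, pt 3, pt 4}, {pt 1, pt 7, pt 9},
   {pt 2, pt 6, pt 9}, {pt 2, pt 7, pt 8}, {pt 3, pt 5, pt 9},
   {pt 3, pt 6, pt 8}, {pt 4, pt 5, pt 8}, {pt 4, pt 6, pt 7}}

set_option maxRecDepth 10000 in
theorem hcvLines_card : ∀ L ∈ hcvLines, L.card = 3 := by decide

set_option maxRecDepth 10000 in
theorem hcvLines_inter :
    ∀ L ∈ hcvLines, ∀ L' ∈ hcvLines, 2 ≤ (L ∩ L').card → L = L' := by decide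

/-- The rank three matroid of the `(9_3)_2` configuration: a set is independent if it has at most
three elements and is not one of the nine lines. -/
def hcvIndepMatroid : IndepMatroid (Fin 9) :=
  IndepMatroid.ofFinset Set.univ (fun I => I.card ≤ 3 ∧ I ∉ hcvLines)
    ⟨by simp, by decide⟩
    (by
      intro I J hJ hIJ
      refine ⟨(Finset.card_le_card hIJ).trans hJ.1, fun hI => hJ.2 ?_⟩
      have h : I = J := Finset.eq_of_subset_of_card_le hIJ (by rw [hcvLines_card I hI]; exact hJ.1)
      exact h ▸ hI)
    (by
      intro I J hI hJ hlt
      by_contra! hcon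
      have key : ∀ e ∈ J, e ∉ I → insert e I ∈ hcvLines := by
        intro e he heI
        by_contra hne
        refine hne (hcon e he heI ?_)
        rw [Finset.card_insert_of_notMem heI]
        exact hlt.trans_le hJ.1
      obtain ⟨e, he, heI⟩ := Finset.exists_mem_notMem_of_card_lt_card hlt
      have hL := key e he heI
      have hI2 : I.card = 2 := by
        have h := hcvLines_card _ hL
        rw [Finset.card_insert_of_notMem heI] at h
        omega
      have hJI : J ⊆ insert e I := by
        intro f hf
        by_cases hfI : f ∈ I
        · exact Finset.mem_insert_of_mem hfI
        · have hle : 2 ≤ (insert e I ∩ insert f I).card := by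
            rw [← hI2]
            exact Finset.card_le_card
              (Finset.subset_inter (Finset.subset_insert _ _) (Finset.subset_insert _ _))
          rw [hcvLines_inter _ hL _ (key f hf hfI) hle]
          exact Finset.mem_insert_self _ _
      have hJL : J = insert e I := Finset.eq_of_subset_of_card_le hJI (by
        rw [Finset.card_insert_of_notMem heI]; omega)
      exact hJ.2 (hJL ▸ hL))
    (fun _ _ => Set.subset_univ _)

/-- The matroid of the `(9_3)_2` configuration. -/
def hcv : Matroid (Fin 9) := hcvIndepMatroid.matroid

theorem hcv_indep_iff (I : Finset (Fin 9)) :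
    hcv.Indep (I : Set (Fin 9)) ↔ I.card ≤ 3 ∧ I ∉ hcvLines :=
  by
  rw [hcv, IndepMatroid.matroid_Indep, hcvIndepMatroid, IndepMatroid.ofFinset_indep]

/-- The permutation `τ = [2 6 1 5 9 4 8 3 7]` of the nine points (as a map). -/
def tau : Fin 9 → Fin 9 := ![pt 2, pt 6, pt 1, pt 5, pt 9, pt 4, pt 8, pt 3, pt 7]

/-- The algebra endomorphism of `E` with `e_i ↦ e_{τ(i)}`. -/
def tauAlg : Ext R 9 →ₐ[R] Ext R 9 :=
  ExteriorAlgebra.map ((Pi.basisFun R (Fin 9)).constr R (fun i => Pi.single (tau i) 1))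

theorem tauAlg_gen (i : Fin 9) : tauAlg R (gen R i) = gen R (tau i) := by
  have h := (Pi.basisFun R (Fin 9)).constr_basis R
    (fun i => (Pi.single (tau i) 1 : Fin 9 → R)) i
  rw [Pi.basisFun_apply] at h
  rw [tauAlg, gen, ExteriorAlgebra.map_apply_ι, h, gen]

/-- The product `e_{k_1} ⋯ e_{k_r}` for labels `k_1, …, k_r ∈ {1, …, 9}`. -/
def word (l : List ℕ) : Ext R 9 := (l.map (fun k => gen R (pt k))).prod

/-- `x = e₁e₂e₃e₆e₈ - e₁e₂e₄e₆e₉ + e₁e₂e₄e₈e₉ - e₁e₂e₆e₈e₉ - e₂e₃e₅e₆e₉`. -/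
def xElt : Ext R 9 :=
  word R [1, 2, 3, 6, 8] - word R [1, 2, 4, 6, 9] + word R [1, 2, 4, 8, 9]
    - word R [1, 2, 6, 8, 9] - word R [2, 3, 5, 6, 9]

/-- `(1 + τ³ + τ⁶) x`. -/
def yElt : Ext R 9 :=
  xElt R + (tauAlg R)^[3] (xElt R) + (tauAlg R)^[6] (xElt R)

/-- `p = (1 - τ)(1 + τ³ + τ⁶) x`. -/
def pElt : Ext R 9 := yElt R - tauAlg R (yElt R)

/-- `q = τ p`. -/
def qElt : Ext R 9 := tauAlg R (pElt R)

end OrlikSolomon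

end

open OrlikSolomon

open OrlikSolomon

namespace OrlikSolomon

open ExteriorAlgebra

variable (R : Type*) [CommRing R]

/-! ### Sorting words in the generators -/

/-! The ring `R` is arbitrary, so every identity is verified with integer coefficients on explicit
combinations of words in the generators, by kernel evaluation, and then transported to `E` by
`Poly.eval`. The resulting facts survive every change of ring because all coefficients that have to
be inverted are `±1`. Linear independence and vanishing are detected by multiplying into the top
degree, which is free on `topElt`.

Not quadratic: `I₂` is spanned by the nine elements `∂ e_L`, so `J₃` is spanned by the products `e_i
∂ e_L`. For `i ∈ L` such a product is `± e_L`, which leaves `9 + 9 · 6 = 63` generators. On the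
other hand `I₃` is the sum of `∂ E₄`, with basis the `56` elements `∂ (e₁ e_S)`, and the span of the
nine `e_L`. An explicit dual family shows that this sum is direct, hence free of rank `65`.

The annihilator in degree five: an element `a` of `E₅` is the same as the functional `b ↦ a b` on
`E₄`, and `a ∈ J⁰` makes this functional vanish on the elements `e_i e_j ∂ e_L`. These have one or
three terms (or vanish), with coefficients `±1`. Solving them one after another expresses every word
of length four through `e₁e₂e₃e₆` and `e₁e₂e₃e₈` (`percolates_quarticRelations`). So `a` is
determined by two values, and on these two words `p` and `q` have an invertible matrix of values.

Purity: a pure element of degree five satisfies the Plücker relations. For `α p + β q` two of their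
coefficients are `-α²` and `-β²`, so `α = β = 0` as soon as `R` is reduced.

`3`-independence: four parts of a partition give a colouring of the points by four colours. A finite
search finds a line with three different colours, and its points form a dependent choice from three
parts. -/

/-- The labels `1, …, 9`. -/
def labels : List ℕ := [1, 2, 3, 4, 5, 6, 7, 8, 9]

/-- The increasing words of length `p` in the labels. -/
def sortedWords (p : ℕ) : List (List ℕ) := labels.sublistsLen p

theorem gen_mul_self {n : ℕ} (i : Fin n) : gen R i * gen R i = 0 := ι_sq_zero _

theorem gen_mul_gen {n : ℕ} (i j : Fin n) : gen R i * gen R j = -(gen R j * gen R i) :=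
  eq_neg_of_add_eq_zero_left (ι_add_mul_swap _ _)

theorem word_nil : word R [] = 1 := rfl

theorem word_cons (k : ℕ) (l : List ℕ) : word R (k :: l) = gen R (pt k) * word R l := by
  simp [word]

theorem word_append (l m : List ℕ) : word R (l ++ m) = word R l * word R m := by
  simp [word]

/-- The product of the generator with label `k` and an increasing word, as a signed increasing
word. -/
def insertGen (k : ℕ) : List ℕ → ℤ × List ℕ
  | [] => (1, [k])
  | a :: l => if k < a then (1, k :: a :: l) else if k = a then (0, []) else
      match insertGen k l with
      | (c, m) => (-c, a :: m)

theorem insertGen_spec (k : ℕ) (l : List ℕ) :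
    gen R (pt k) * word R l = (insertGen k l).1 • word R (insertGen k l).2 := by
  induction l with
  | nil => simp [insertGen, word]
  | cons a l ih =>
    unfold insertGen
    split_ifs with h1 h2
    · simp [word_cons]
    · subst h2
      simp [word_cons, ← mul_assoc, gen_mul_self]
    -- Moving the new generator past a smaller one costs a sign.
    · simp only [word_cons]
      rw [← mul_assoc, gen_mul_gen, neg_mul, mul_assoc, ih, mul_smul_comm, neg_smul]

/-- A word as a signed increasing word. -/
def sortWord : List ℕ → ℤ × List ℕ
  | [] => (1, [])
  | k :: l => match sortWord l with
    | (c, m) => match insertGen k m with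
      | (d, m') => (c * d, m')

theorem sortWord_spec (l : List ℕ) : word R l = (sortWord l).1 • word R (sortWord l).2 := by
  induction l with
  | nil => simp [sortWord]
  | cons k l ih =>
    simp only [sortWord]
    rw [word_cons, ih, mul_smul_comm, insertGen_spec, mul_smul]

/-! ### Integral polynomials in the generators -/

/-- Integral linear combinations of words. -/
abbrev Poly : Type := List (ℤ × List ℕ)

namespace Poly

/-- The element of `E` represented by a combination of words. -/
def eval (f : Poly) : Ext R 9 := (f.map fun t => t.1 • word R t.2).sum

@[simp] theorem eval_nil : eval R [] = 0 := rfl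

@[simp] theorem eval_cons (t : ℤ × List ℕ) (f : Poly) :
    eval R (t :: f) = t.1 • word R t.2 + eval R f := by
  simp [eval]

theorem eval_append (f g : Poly) : eval R (f ++ g) = eval R f + eval R g := by
  simp [eval]

/-- Scalar multiplication. -/
def smul (c : ℤ) (f : Poly) : Poly := f.map fun t => (c * t.1, t.2)

theorem eval_smul (c : ℤ) (f : Poly) : eval R (smul c f) = c • eval R f := by
  induction f with
  | nil => simp [smul]
  | cons t f ih =>
    simp only [smul, List.map_cons, eval_cons] at ih ⊢
    rw [ih, smul_add, mul_smul]

/-- Multiplication. -/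
def mul (f g : Poly) : Poly := f.flatMap fun s => g.map fun t => (s.1 * t.1, s.2 ++ t.2)

theorem eval_mul (f g : Poly) : eval R (mul f g) = eval R f * eval R g := by
  induction f with
  | nil => simp [mul]
  | cons s f ih =>
    have h : eval R (g.map fun t => (s.1 * t.1, s.2 ++ t.2)) =
        s.1 • word R s.2 * eval R g := by
      clear ih
      induction g with
      | nil => simp
      | cons t g ih =>
        rw [List.map_cons, eval_cons, ih, eval_cons, mul_add, word_append, smul_mul_smul_comm]
    simp only [mul, List.flatMap_cons, eval_append, eval_cons, add_mul] at ih ⊢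
    rw [ih, h]

/-- Add a multiple of a word. -/
def addTerm (t : ℤ × List ℕ) : Poly → Poly
  | [] => [t]
  | s :: f => if t.2 = s.2 then (t.1 + s.1, s.2) :: f else s :: addTerm t f

theorem eval_addTerm (t : ℤ × List ℕ) (f : Poly) :
    eval R (addTerm t f) = t.1 • word R t.2 + eval R f := by
  induction f with
  | nil => simp [addTerm]
  | cons s f ih =>
    unfold addTerm
    split_ifs with h
    · rw [eval_cons, eval_cons, h, add_smul, add_assoc]
    · rw [eval_cons, eval_cons, ih, add_left_comm]

/-- Sort all words and collect equal ones. -/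
def normalize : Poly → Poly
  | [] => []
  | t :: f => match sortWord t.2 with
    | (c, l) => if t.1 * c = 0 then normalize f else addTerm (t.1 * c, l) (normalize f)

theorem eval_normalize (f : Poly) : eval R (normalize f) = eval R f := by
  induction f with
  | nil => rfl
  | cons t f ih =>
    simp only [normalize]
    split_ifs with h
    · rw [ih, eval_cons, sortWord_spec, ← mul_smul, h, zero_smul, zero_add]
    · rw [eval_addTerm, ih, eval_cons, sortWord_spec R t.2, mul_smul]

/-- A sufficient criterion for representing zero. -/
def isZero (f : Poly) : Bool := (normalize f).all fun t => decide (t.1 = 0)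

theorem eval_eq_zero {f : Poly} (h : f.isZero = true) : eval R f = 0 := by
  rw [← eval_normalize]
  simp only [isZero, List.all_eq_true, decide_eq_true_eq] at h
  refine List.sum_eq_zero fun x hx => ?_
  obtain ⟨t, ht, rfl⟩ := List.mem_map.1 hx
  rw [h t ht, zero_smul]

/-- A sufficient criterion for representing the same element. -/
def equiv (f g : Poly) : Bool := isZero (f ++ smul (-1) g)

theorem eval_eq_of_equiv {f g : Poly} (h : f.equiv g = true) : eval R f = eval R g := by
  have := eval_eq_zero R h
  rwa [eval_append, eval_smul, neg_one_smul, ← sub_eq_add_neg, sub_eq_zero] at this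

/-- A single word. -/
def ofWord (l : List ℕ) : Poly := [(1, l)]

theorem eval_ofWord (l : List ℕ) : eval R (ofWord l) = word R l := by
  simp [ofWord]

/-- The permutation `τ` on labels. -/
def tauLabel (k : ℕ) : ℕ := (tau (pt k)).val + 1

theorem pt_val_add_one (i : Fin 9) : pt (i.val + 1) = i := by
  revert i; decide

theorem pt_tauLabel (k : ℕ) : pt (tauLabel k) = tau (pt k) := pt_val_add_one _

/-- The automorphism `τ`. -/
def applyTau (f : Poly) : Poly := f.map fun t => (t.1, t.2.map tauLabel)

theorem tauAlg_word (l : List ℕ) : tauAlg R (word R l) = word R (l.map tauLabel) := by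
  induction l with
  | nil => simp [word]
  | cons k l ih => rw [List.map_cons, word_cons, word_cons, map_mul, ih, tauAlg_gen, pt_tauLabel]

theorem eval_applyTau (f : Poly) : eval R (applyTau f) = tauAlg R (eval R f) := by
  induction f with
  | nil => simp [applyTau]
  | cons t f ih =>
    simp only [applyTau, List.map_cons, eval_cons] at ih ⊢
    rw [ih, map_add, map_zsmul, tauAlg_word]

/-- The contraction of a word with the linear form given on the generators by `c`. -/
def contractWord (c : ℕ → ℤ) : List ℕ → Poly
  | [] => []
  | k :: l => (c k, l) :: (contractWord c l).map fun t => (-t.1, k :: t.2)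

/-- The contraction with the linear form given on the generators by `c`. -/
def contract (c : ℕ → ℤ) (f : Poly) : Poly := f.flatMap fun t => smul t.1 (contractWord c t.2)

end Poly

/-- The left contraction on `E` with a linear form. -/
def contraction (d : Module.Dual R (Fin 9 → R)) : Ext R 9 →ₗ[R] Ext R 9 :=
  CliffordAlgebra.contractLeft (Q := (0 : QuadraticForm R (Fin 9 → R))) d

theorem contraction_ι_mul (d : Module.Dual R (Fin 9 → R)) (v : Fin 9 → R) (b : Ext R 9) :
    contraction R d (ι R v * b) = d v • b - ι R v * contraction R d b :=
  CliffordAlgebra.contractLeft_ι_mul _ _ _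

theorem contraction_one (d : Module.Dual R (Fin 9 → R)) : contraction R d 1 = 0 :=
  CliffordAlgebra.contractLeft_one _ _

namespace Poly

variable {R}

theorem eval_contractWord {d : Module.Dual R (Fin 9 → R)} {c : ℕ → ℤ}
    (h : ∀ k, d (Pi.single (pt k) 1) = (c k : R)) (l : List ℕ) :
    eval R (contractWord c l) = contraction R d (word R l) := by
  induction l with
  | nil => rw [word_nil, contraction_one]; rfl
  | cons k l ih =>
    have h' : ∀ f : Poly, eval R (f.map fun t => (-t.1, k :: t.2)) =
        -(gen R (pt k) * eval R f) := by
      intro f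
      induction f with
      | nil => simp
      | cons t f ih => simp only [List.map_cons, eval_cons, ih, word_cons, neg_smul, mul_add,
          mul_smul_comm, neg_add]
    rw [contractWord, eval_cons, h', ih, word_cons, gen, contraction_ι_mul, h, sub_eq_add_neg,
      Int.cast_smul_eq_zsmul]

theorem eval_contract {d : Module.Dual R (Fin 9 → R)} {c : ℕ → ℤ}
    (h : ∀ k, d (Pi.single (pt k) 1) = (c k : R)) (f : Poly) :
    eval R (contract c f) = contraction R d (eval R f) := by
  induction f with
  | nil => simp [contract]
  | cons t f ih =>
    simp only [contract, List.flatMap_cons, eval_append] at ih ⊢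
    rw [ih, eval_cons, map_add, map_zsmul, eval_smul, eval_contractWord h]

/-- The differential. -/
def deriv (f : Poly) : Poly := contract (fun _ => 1) f

theorem eval_deriv (f : Poly) : eval R (deriv f) = differential R 9 (eval R f) :=
  eval_contract (d := ∑ i : Fin 9, LinearMap.proj i) (fun k => by
    simp [LinearMap.sum_apply, Pi.single_apply]) f

/-- The contraction with a coordinate form. -/
def coordContract (i : ℕ) (f : Poly) : Poly :=
  normalize (contract (fun k => if pt k = pt i then 1 else 0) f)

theorem eval_coordContract (i : ℕ) (f : Poly) :
    eval R (coordContract i f) = contraction R (LinearMap.proj (pt i)) (eval R f) := by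
  rw [coordContract, eval_normalize]
  exact eval_contract (fun k => by simp [Pi.single_apply, eq_comm]) f

end Poly

/-! ### Homogeneous components -/

theorem word_mem (l : List ℕ) : word R l ∈ ⋀[R]^l.length (Fin 9 → R) := by
  induction l with
  | nil => exact Submodule.one_le.1 (by simp)
  | cons k l ih =>
    rw [word_cons, List.length_cons, exteriorPower, pow_succ']
    exact Submodule.mul_mem_mul ⟨_, rfl⟩ ih

theorem range_ι_eq_span : LinearMap.range (ι R : (Fin 9 → R) →ₗ[R] _) =
    Submodule.span R (Set.range (gen R : Fin 9 → Ext R 9)) := by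
  rw [LinearMap.range_eq_map, ← (Pi.basisFun R (Fin 9)).span_eq, Submodule.map_span,
    ← Set.range_comp]
  congr 2
  funext i
  simp [gen]

theorem insertGen_mem_sortedWords : ∀ p < 9, ∀ k ∈ labels, ∀ l ∈ sortedWords p,
    (insertGen k l).1 = 0 ∨ (insertGen k l).2 ∈ sortedWords (p + 1) := by
  decide +kernel

/-- Multiplying an increasing word by a generator gives zero or a signed increasing word, so the
increasing words span each degree by induction. -/
theorem exteriorPower_le_span (p : ℕ) (hp : p ≤ 9) : ⋀[R]^p (Fin 9 → R) ≤
    Submodule.span R {a | ∃ l ∈ sortedWords p, a = word R l} := by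
  induction p with
  | zero =>
    rw [exteriorPower, pow_zero, Submodule.one_le]
    exact Submodule.subset_span ⟨[], by decide, rfl⟩
  | succ p ih =>
    suffices key : Submodule.span R (Set.range (gen R : Fin 9 → Ext R 9)) *
        Submodule.span R {a | ∃ l ∈ sortedWords p, a = word R l} ≤
        Submodule.span R {a | ∃ l ∈ sortedWords (p + 1), a = word R l} by
      rw [exteriorPower, pow_succ', Submodule.mul_le]
      intro m hm n hn
      rw [range_ι_eq_span] at hm
      exact key (Submodule.mul_mem_mul hm (ih (by omega) hn))
    rw [Submodule.span_mul_span, Submodule.span_le]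
    rintro _ ⟨_, ⟨i, rfl⟩, _, ⟨l, hl, rfl⟩, rfl⟩
    have hi : i.val + 1 ∈ labels := by revert i; decide
    have h := insertGen_spec R (i.val + 1) l
    rw [Poly.pt_val_add_one] at h
    simp only [h]
    rcases insertGen_mem_sortedWords p (by omega) _ hi l hl with h0 | h0
    · rw [h0, zero_smul]; exact zero_mem _
    · refine zsmul_mem (Submodule.subset_span ?_) _
      exact ⟨_, h0, rfl⟩

/-! ### The top degree -/

/-- The product of all generators. -/
def topElt : Ext R 9 := word R labels

/-- The determinant, extended by zero to the other degrees, is a linear form on `E` with value `1`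
at the top element. -/
theorem smul_topElt_injective {r : R} (h : r • topElt R = 0) : r = 0 := by
  classical
  let F : ∀ i, (Fin 9 → R) [⋀^Fin i]→ₗ[R] R :=
    fun i => if hi : i = 9 then hi ▸ (Matrix.detRowAlternating (R := R) (n := Fin 9)) else 0
  have h1 : topElt R = ιMulti R 9 (fun i => Pi.single i 1) := by
    rw [ιMulti_apply]; rfl
  have h2 : liftAlternating F (topElt R) = 1 := by
    rw [h1, liftAlternating_apply_ιMulti]
    have : (fun i : Fin 9 => (Pi.single i 1 : Fin 9 → R)) = (1 : Matrix (Fin 9) (Fin 9) R) := by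
      funext i j; simp [Matrix.one_apply, Pi.single_apply, eq_comm]
    rw [this]
    exact Matrix.det_one
  have := congrArg (liftAlternating F) h
  rwa [map_smul, h2, map_zero, smul_eq_mul, mul_one] at this

theorem exists_eq_smul_topElt {a : Ext R 9} (ha : a ∈ ⋀[R]^9 (Fin 9 → R)) :
    ∃ r : R, a = r • topElt R := by
  have h := exteriorPower_le_span R 9 le_rfl ha
  have : {a | ∃ l ∈ sortedWords 9, a = word R l} = {topElt R} := by
    ext a
    rw [show sortedWords 9 = [labels] by decide +kernel]
    simp [topElt]
  rw [this, Submodule.mem_span_singleton] at h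
  exact h.imp fun _ h => h.symm

/-! ### Ideals with homogeneous generators -/

theorem span_word_eq_top : Submodule.span R (Set.range (word R)) = ⊤ := by
  rw [eq_top_iff]
  have hmul : ∀ a ∈ Submodule.span R (Set.range (word R)),
      ∀ b ∈ Submodule.span R (Set.range (word R)),
      a * b ∈ Submodule.span R (Set.range (word R)) := by
    intro a ha b hb
    have h := Submodule.mul_mem_mul ha hb
    rw [Submodule.span_mul_span] at h
    refine Submodule.span_mono ?_ h
    rintro _ ⟨_, ⟨l, rfl⟩, _, ⟨m, rfl⟩, rfl⟩
    exact ⟨l ++ m, word_append R l m⟩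
  rintro a -
  induction a using ExteriorAlgebra.induction with
  | algebraMap r =>
    rw [Algebra.algebraMap_eq_smul_one]
    exact Submodule.smul_mem _ _ (Submodule.subset_span ⟨[], rfl⟩)
  | ι v =>
    have h : ι R v ∈ Submodule.span R (Set.range (gen R : Fin 9 → Ext R 9)) := by
      rw [← range_ι_eq_span]; exact ⟨v, rfl⟩
    refine Submodule.span_mono ?_ h
    rintro _ ⟨i, rfl⟩
    exact ⟨[i.val + 1], by rw [word_cons, word_nil, mul_one, Poly.pt_val_add_one]⟩
  | mul a b ha hb => exact hmul a ha b hb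
  | add a b ha hb => exact add_mem ha hb

/-- The ideal generated by a set is spanned by the products of its elements with words. -/
theorem mem_of_mem_span {S : Set (Ext R 9)} {N : Submodule R (Ext R 9)}
    (h : ∀ s ∈ S, ∀ l m, word R l * s * word R m ∈ N) {a : Ext R 9}
    (ha : a ∈ TwoSidedIdeal.span S) : a ∈ N := by
  have h1 : ∀ s ∈ S, ∀ x y, x * s * y ∈ N := by
    intro s hs x y
    have hx : x ∈ Submodule.span R (Set.range (word R)) := by
      rw [span_word_eq_top]; trivial
    have hy : y ∈ Submodule.span R (Set.range (word R)) := by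
      rw [span_word_eq_top]; trivial
    induction hx using Submodule.span_induction with
    | mem _ hx =>
      obtain ⟨l, rfl⟩ := hx
      induction hy using Submodule.span_induction with
      | mem _ hy => obtain ⟨m, rfl⟩ := hy; exact h s hs l m
      | zero => rw [mul_zero]; exact zero_mem _
      | add _ _ _ _ h1 h2 => rw [mul_add]; exact add_mem h1 h2
      | smul r _ _ h1 => rw [mul_smul_comm]; exact Submodule.smul_mem _ _ h1
    | zero => rw [zero_mul, zero_mul]; exact zero_mem _
    | add _ _ _ _ h1 h2 => rw [add_mul, add_mul]; exact add_mem h1 h2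
    | smul r _ _ h1 => rw [smul_mul_assoc, smul_mul_assoc]; exact Submodule.smul_mem _ _ h1
  -- `N` is only a submodule, so the induction needs the statement with arbitrary factors on both
  -- sides.
  suffices ∀ x y, x * a * y ∈ N by simpa using this 1 1
  induction ha using TwoSidedIdeal.span_induction with
  | mem s hs => exact h1 s hs
  | zero => intro x y; simp
  | add a b _ _ ha hb => intro x y; rw [mul_add, add_mul]; exact add_mem (ha x y) (hb x y)
  | neg a _ ha => intro x y; rw [mul_neg, neg_mul]; exact neg_mem (ha x y)
  | left_absorb b a _ ha => intro x y; rw [← mul_assoc]; exact ha (x * b) y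
  | right_absorb b a _ ha =>
    intro x y; rw [← mul_assoc, mul_assoc]; exact ha x (b * y)

theorem mem_component {n : ℕ} {I : TwoSidedIdeal (Ext R n)} {p : ℕ} {a : Ext R n} :
    a ∈ component R I p ↔ a ∈ I ∧ a ∈ ⋀[R]^p (Fin n → R) := Iff.rfl

theorem eq_zero_of_mem_of_mem {n p q : ℕ} (h : p ≠ q) {a : Ext R n}
    (hp : a ∈ ⋀[R]^p (Fin n → R)) (hq : a ∈ ⋀[R]^q (Fin n → R)) : a = 0 := by
  rw [← DirectSum.decompose_of_mem_same (fun i : ℕ => ⋀[R]^i (Fin n → R)) hp,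
    DirectSum.decompose_of_mem_ne (fun i : ℕ => ⋀[R]^i (Fin n → R)) hq h.symm]

/-- The components of an ideal with homogeneous generators. -/
theorem component_span_le {S : Set (Ext R 9)} {p : ℕ} {N : Submodule R (Ext R 9)}
    (h : ∀ s ∈ S, ∃ d, s ∈ ⋀[R]^d (Fin 9 → R) ∧
      ∀ l m : List ℕ, l.length + d + m.length = p → word R l * s * word R m ∈ N) :
    component R (TwoSidedIdeal.span S) p ≤ N := by
  intro a ha
  rw [mem_component] at ha
  -- Pulling `N` back along the projection to degree `p` makes all products of another degree
  -- harmless, since they project to zero.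
  have key : a ∈ N.comap (GradedAlgebra.proj (fun i : ℕ => ⋀[R]^i (Fin 9 → R)) p) := by
    refine mem_of_mem_span R (S := S) ?_ ha.1
    intro s hs l m
    obtain ⟨d, hd, hN⟩ := h s hs
    have hmem : word R l * s * word R m ∈ ⋀[R]^(l.length + d + m.length) (Fin 9 → R) :=
      SetLike.mul_mem_graded (A := fun i : ℕ => ⋀[R]^i (Fin 9 → R))
        (SetLike.mul_mem_graded (A := fun i : ℕ => ⋀[R]^i (Fin 9 → R)) (word_mem R l) hd)
        (word_mem R m)
    rw [Submodule.mem_comap, GradedAlgebra.proj_apply]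
    by_cases hp : l.length + d + m.length = p
    · rw [← hp, DirectSum.decompose_of_mem_same (fun i : ℕ => ⋀[R]^i (Fin 9 → R)) hmem]
      exact hN l m hp
    · rw [DirectSum.decompose_of_mem_ne (fun i : ℕ => ⋀[R]^i (Fin 9 → R)) hmem hp]
      exact zero_mem _
  rwa [Submodule.mem_comap, GradedAlgebra.proj_apply,
    DirectSum.decompose_of_mem_same (fun i : ℕ => ⋀[R]^i (Fin 9 → R)) ha.2] at key

/-! ### Families with a dual family -/

theorem eq_zero_of_pairing {ι : Type*} [Fintype ι] [DecidableEq ι] {v w : ι → Ext R 9}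
    (h : ∀ i j, v i * w j = if i = j then topElt R else 0) {c : ι → R}
    (hc : ∀ j, (∑ i, c i • v i) * w j = 0) (i : ι) : c i = 0 := by
  refine smul_topElt_injective R ?_
  have := hc i
  rw [Finset.sum_mul] at this
  simpa [smul_mul_assoc, h] using this

theorem linearIndependent_of_pairing {ι : Type*} [Fintype ι] [DecidableEq ι] {v w : ι → Ext R 9}
    (h : ∀ i j, v i * w j = if i = j then topElt R else 0) : LinearIndependent R v :=
  Fintype.linearIndependent_iff.2 fun c hc i =>
    eq_zero_of_pairing R h (fun j => by rw [hc, zero_mul]) i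

theorem eq_zero_of_mem_span_of_pairing {ι : Type*} [Fintype ι] [DecidableEq ι]
    {v w : ι → Ext R 9} (h : ∀ i j, v i * w j = if i = j then topElt R else 0) {a : Ext R 9}
    (ha : a ∈ Submodule.span R (Set.range v)) (hw : ∀ j, a * w j = 0) : a = 0 := by
  obtain ⟨c, rfl⟩ := (Submodule.mem_span_range_iff_exists_fun R).1 ha
  exact Finset.sum_eq_zero fun i _ => by rw [eq_zero_of_pairing R h hw i, zero_smul]

namespace Poly

/-- The complement of a word. -/
def compl (l : List ℕ) : List ℕ := labels.filter fun k => !l.contains k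

/-- Check that two families of combinations of words are dual to each other. -/
def dualCheck (V W : List Poly) : Bool :=
  (V.zipIdx).all fun v => (W.zipIdx).all fun w =>
    if v.2 = w.2 then equiv (mul v.1 w.1) (ofWord labels) else isZero (mul v.1 w.1)

theorem pairing_of_dualCheck {V W : List Poly} (h : dualCheck V W = true)
    (hVW : V.length = W.length) (i j : Fin V.length) :
    eval R V[i] * eval R (W[j.val]'(hVW ▸ j.2)) = if i = j then topElt R else 0 := by
  simp only [dualCheck, List.all_eq_true] at h
  have hi : (V[i.val], i.val) ∈ V.zipIdx := List.mk_mem_zipIdx_iff_getElem?.2 (by simp)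
  have hj : (W[j.val]'(hVW ▸ j.2), j.val) ∈ W.zipIdx :=
    List.mk_mem_zipIdx_iff_getElem?.2 (by simp)
  have := h _ hi _ hj
  by_cases hij : i = j
  · subst hij
    simp only [if_true] at this ⊢
    have := eval_eq_of_equiv R this
    rwa [eval_mul, eval_ofWord] at this
  · rw [if_neg hij]
    simp only [Fin.val_inj, hij, if_false] at this
    have := eval_eq_zero R this
    rwa [eval_mul] at this

/-- The complementary word with the sign making its product with the given word the top one. -/
def dualWord (l : List ℕ) : Poly := [((sortWord (l ++ compl l)).1, compl l)]

/-- The pairing of degrees five and four into the top degree is perfect: words are dual to their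
signed complements. -/
theorem dualCheck_sortedWords :
    dualCheck ((sortedWords 5).map ofWord) ((sortedWords 5).map dualWord) = true := by
  decide +kernel

end Poly

/-- An element of degree five is determined by its products with the words of length four. -/
theorem eq_zero_of_mul_word_eq_zero {a : Ext R 9} (ha : a ∈ ⋀[R]^5 (Fin 9 → R))
    (h : ∀ l ∈ sortedWords 4, a * word R l = 0) : a = 0 := by
  refine eq_zero_of_mem_span_of_pairing R
    (Poly.pairing_of_dualCheck R Poly.dualCheck_sortedWords (by simp)) ?_ ?_
  · refine Submodule.span_mono ?_ (exteriorPower_le_span R 5 (by norm_num) ha)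
    rintro _ ⟨l, hl, rfl⟩
    obtain ⟨i, hi, rfl⟩ := List.getElem_of_mem hl
    exact ⟨⟨i, by simpa using hi⟩, by simp [Poly.eval_ofWord]⟩
  · intro j
    have hj : j.val < (sortedWords 5).length := by simpa using j.2
    have hc : ∀ l ∈ sortedWords 5, Poly.compl l ∈ sortedWords 4 := by decide +kernel
    simp only [List.getElem_map, Poly.dualWord, Poly.eval_cons, Poly.eval_nil, add_zero,
      mul_smul_comm]
    rw [h _ (hc _ (List.getElem_mem hj)), smul_zero]

/-! ### The generators of degree two -/

/-- The nine lines as increasing words. -/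
def lineWords : List (List ℕ) :=
  [[1, 2, 5], [1, 3, 4], [1, 7, 9], [2, 6, 9], [2, 7, 8], [3, 5, 9], [3, 6, 8], [4, 5, 8],
    [4, 6, 7]]

theorem mono_toFinset {l : List ℕ} (h : (l.map pt).Pairwise (· < ·)) :
    mono R (l.map pt).toFinset = word R l := by
  rw [mono, (List.toFinset_sort (· ≤ ·) (h.imp ne_of_lt)).2 (h.imp le_of_lt), List.map_map]
  rfl

set_option maxRecDepth 10000 in
theorem exists_lineWord : ∀ S ∈ hcvLines, ∃ l ∈ lineWords, S = (l.map pt).toFinset := by decide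

set_option maxRecDepth 10000 in
theorem lineWord_mem : ∀ l ∈ lineWords, (l.map pt).toFinset ∈ hcvLines := by decide

theorem lineWord_pairwise : ∀ l ∈ lineWords, (l.map pt).Pairwise (· < ·) := by decide

theorem lineWord_length : ∀ l ∈ lineWords, l.length = 3 := by decide

theorem hcv_dep_iff (S : Finset (Fin 9)) :
    hcv.Dep (S : Set (Fin 9)) ↔ 3 < S.card ∨ S ∈ hcvLines := by
  have hE : hcv.E = Set.univ := rfl
  rw [Matroid.dep_iff, hcv_indep_iff, hE]
  simp only [Set.subset_univ, and_true, not_and_or, not_not, not_le]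

theorem three_le_card_of_dep {S : Finset (Fin 9)} (hS : hcv.Dep (S : Set (Fin 9))) :
    3 ≤ S.card := by
  rcases (hcv_dep_iff S).1 hS with h | h
  · exact h.le
  · exact (hcvLines_card S h).ge

theorem differential_word_cons (k : ℕ) (l : List ℕ) :
    differential R 9 (word R (k :: l)) = word R l - gen R (pt k) * differential R 9 (word R l) := by
  rw [word_cons, differential_gen_mul]

theorem differential_word_mem (l : List ℕ) :
    differential R 9 (word R l) ∈ ⋀[R]^(l.length - 1) (Fin 9 → R) := by
  induction l with
  | nil => rw [word_nil, differential_one]; exact zero_mem _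
  | cons k l ih =>
    rw [differential_word_cons]
    refine sub_mem (word_mem R l) ?_
    rcases l with _ | ⟨j, l⟩
    · rw [word_nil, differential_one, mul_zero]; exact zero_mem _
    · have := word_mem R [k]
      rw [word_cons, word_nil, mul_one] at this
      have := SetLike.mul_mem_graded (A := fun i : ℕ => ⋀[R]^i (Fin 9 → R)) this ih
      simpa [add_comm] using this

theorem mono_eq_word (S : Finset (Fin 9)) :
    mono R S = word R (S.sort.map fun i => i.val + 1) := by
  simp [mono, word, Poly.pt_val_add_one, List.map_map, Function.comp_def]

theorem differential_mono_mem (S : Finset (Fin 9)) :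
    differential R 9 (mono R S) ∈ ⋀[R]^(S.card - 1) (Fin 9 → R) := by
  have := differential_word_mem R (S.sort.map fun i => i.val + 1)
  rwa [← mono_eq_word, List.length_map, Finset.length_sort] at this

theorem differential_mono_mem_osIdeal {S : Finset (Fin 9)} (hS : hcv.Dep (S : Set (Fin 9))) :
    differential R 9 (mono R S) ∈ osIdeal R hcv :=
  TwoSidedIdeal.subset_span ⟨S, hS, rfl⟩

/-- The span of the nine elements `∂ e_L`. -/
def lineSpan : Submodule R (Ext R 9) :=
  Submodule.span R {a | ∃ l ∈ lineWords, a = differential R 9 (word R l)}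

/-- A generator `∂ e_S` has degree `|S| - 1 ≥ 2`, so only the lines contribute, and without further
factors. -/
theorem component_osIdeal_le_of_le_two {r : ℕ} (hr : r ≤ 2) :
    component R (osIdeal R hcv) r ≤ lineSpan R := by
  refine component_span_le R ?_
  rintro _ ⟨S, hS, rfl⟩
  have h3 := three_le_card_of_dep hS
  refine ⟨S.card - 1, differential_mono_mem R S, fun l m hlm => ?_⟩
  have hl : l = [] := List.length_eq_zero_iff.1 (by omega)
  have hm : m = [] := List.length_eq_zero_iff.1 (by omega)
  have hS3 : S.card = 3 := by omega
  subst hl hm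
  have hSL : S ∈ hcvLines := ((hcv_dep_iff S).1 hS).resolve_left (by omega)
  obtain ⟨l, hl, rfl⟩ := exists_lineWord S hSL
  rw [mono_toFinset R (lineWord_pairwise l hl), word_nil, one_mul, mul_one]
  exact Submodule.subset_span ⟨l, hl, rfl⟩

theorem differential_lineWord_mem {l : List ℕ} (hl : l ∈ lineWords) :
    differential R 9 (word R l) ∈ osIdeal R hcv := by
  rw [← mono_toFinset R (lineWord_pairwise l hl)]
  exact differential_mono_mem_osIdeal R ((hcv_dep_iff _).2 (Or.inr (lineWord_mem l hl)))

theorem differential_lineWord_mem_two {l : List ℕ} (hl : l ∈ lineWords) :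
    differential R 9 (word R l) ∈ ⋀[R]^2 (Fin 9 → R) := by
  have := differential_word_mem R l
  rwa [lineWord_length l hl] at this

theorem lineSpan_le : lineSpan R ≤ ⋀[R]^2 (Fin 9 → R) := by
  rw [lineSpan, Submodule.span_le]
  rintro _ ⟨l, hl, rfl⟩
  exact differential_lineWord_mem_two R hl

theorem differential_lineWord_mem_trunc {l : List ℕ} (hl : l ∈ lineWords) :
    differential R 9 (word R l) ∈ truncIdeal R 2 hcv :=
  TwoSidedIdeal.subset_span
    ⟨2, le_rfl, differential_lineWord_mem R hl, differential_lineWord_mem_two R hl⟩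

/-- Elements of even degree are central. This reduces two-sided products to one-sided ones. -/
theorem lineSpan_commute {a : Ext R 9} (ha : a ∈ lineSpan R) (l : List ℕ) :
    word R l * a = a * word R l := by
  induction ha using Submodule.span_induction with
  | mem _ h =>
    obtain ⟨m, hm, rfl⟩ := h
    induction l with
    | nil => rw [word_nil, one_mul, mul_one]
    | cons k l ih =>
      have key : ∀ i : Fin 9, ∀ m ∈ lineWords, ((Poly.ofWord [i.val + 1]).mul
          (Poly.ofWord m).deriv).equiv ((Poly.ofWord m).deriv.mul (Poly.ofWord [i.val + 1])) =
            true := by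
        decide +kernel
      have := Poly.eval_eq_of_equiv R (key (pt k) m hm)
      simp only [Poly.eval_mul, Poly.eval_deriv, Poly.eval_ofWord, word_cons, word_nil, mul_one,
        Poly.pt_val_add_one] at this
      rw [word_cons, mul_assoc, ih, ← mul_assoc, this, mul_assoc]
  | zero => rw [mul_zero, zero_mul]
  | add _ _ _ _ h1 h2 => rw [mul_add, add_mul, h1, h2]
  | smul r _ _ h => rw [mul_smul_comm, smul_mul_assoc, h]

/-! ### The component `J₃` -/

/-- The elements `e_i ∂ e_L` for `i ∉ L`, and the elements `e_L`. -/
def truncGenerators : List Poly :=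
  lineWords.map Poly.ofWord ++ lineWords.flatMap fun l =>
    (Poly.compl l).map fun k => (Poly.ofWord [k]).mul (Poly.ofWord l).deriv

theorem truncGenerators_length : truncGenerators.length = 63 := by decide +kernel

theorem gen_mul_differential_mem (i : Fin 9) {l : List ℕ} (hl : l ∈ lineWords) :
    gen R i * differential R 9 (word R l) ∈
      Submodule.span R {a | ∃ f ∈ truncGenerators, a = Poly.eval R f} := by
  -- For `i ∈ L` the product `e_i ∂ e_L` is `± e_L`, so the three points of a line contribute a
  -- single generator.
  have key : ∀ i : Fin 9, ∀ l ∈ lineWords, i.val + 1 ∈ Poly.compl l ∨ ∃ c ∈ [1, -1],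
      ((Poly.ofWord [i.val + 1]).mul (Poly.ofWord l).deriv).equiv
        (Poly.smul c (Poly.ofWord l)) = true := by
    decide +kernel
  have hev : Poly.eval R ((Poly.ofWord [i.val + 1]).mul (Poly.ofWord l).deriv) =
      gen R i * differential R 9 (word R l) := by
    simp only [Poly.eval_mul, Poly.eval_deriv, Poly.eval_ofWord, word_cons, word_nil, mul_one,
      Poly.pt_val_add_one]
  rw [← hev]
  rcases key i l hl with h | ⟨c, -, h⟩
  · exact Submodule.subset_span ⟨_, List.mem_append_right _
      (List.mem_flatMap.2 ⟨l, hl, List.mem_map.2 ⟨_, h, rfl⟩⟩), rfl⟩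
  · rw [Poly.eval_eq_of_equiv R h, Poly.eval_smul]
    refine zsmul_mem (Submodule.subset_span ?_) _
    exact ⟨_, List.mem_append_left _ (List.mem_map.2 ⟨l, hl, rfl⟩), rfl⟩

theorem component_truncIdeal_three_le : component R (truncIdeal R 2 hcv) 3 ≤
    Submodule.span R {a | ∃ f ∈ truncGenerators, a = Poly.eval R f} := by
  refine component_span_le R ?_
  rintro a ⟨r, hr, ha⟩
  have ha' := component_osIdeal_le_of_le_two R hr ha
  refine ⟨2, lineSpan_le R ha', fun l m hlm => ?_⟩
  rw [mul_assoc, ← lineSpan_commute R ha', ← mul_assoc, ← word_append]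
  obtain ⟨k, hk⟩ := List.length_eq_one_iff.1 (show (l ++ m).length = 1 by
    rw [List.length_append]; omega)
  rw [hk, word_cons, word_nil, mul_one]
  clear hlm hk ha
  induction ha' using Submodule.span_induction with
  | mem _ h => obtain ⟨l, hl, rfl⟩ := h; exact gen_mul_differential_mem R _ hl
  | zero => rw [mul_zero]; exact zero_mem _
  | add _ _ _ _ h1 h2 => rw [mul_add]; exact add_mem h1 h2
  | smul r _ _ h => rw [mul_smul_comm]; exact Submodule.smul_mem _ _ h

theorem rank_component_truncIdeal_le [Nontrivial R] :
    Module.rank R (component R (truncIdeal R 2 hcv) 3) ≤ 63 := by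
  classical
  refine (Submodule.rank_mono (component_truncIdeal_three_le R)).trans ?_
  have h : {a | ∃ f ∈ truncGenerators, a = Poly.eval R f} =
      ((truncGenerators.map (Poly.eval R)).toFinset : Set (Ext R 9)) := by
    ext a; simp [eq_comm]
  rw [h]
  refine (rank_span_finset_le _).trans ?_
  have := List.toFinset_card_le (truncGenerators.map (Poly.eval R))
  rw [List.length_map, truncGenerators_length] at this
  exact_mod_cast this

/-! ### The component `I₃` -/

/-- A basis of `I₃`: the elements `e_L`, and the elements `∂ (e₁ e_S)` for `1 ∉ S`. -/
def osBasis : List Poly :=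
  lineWords.map Poly.ofWord ++
    (labels.tail.sublistsLen 3).map fun l => (Poly.ofWord (1 :: l)).deriv

/-- The element of degree six dual to `e_L` in the basis of `I₃`. -/
def dualLine (l : List ℕ) : Poly :=
  (Poly.dualWord (l.drop 1)).deriv

/-- The family dual to the basis of `I₃`. -/
def osDual : List Poly :=
  lineWords.map dualLine ++ (labels.tail.sublistsLen 3).map fun l =>
    if l ∈ lineWords then Poly.dualWord l ++ Poly.smul (-1) (dualLine l) else Poly.dualWord l

/-- The dual of `e_L` is a boundary `∂ v`. It kills every `∂ u` of degree three, since `∂ u ∂ v = ∂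
(u ∂ v)` and `u ∂ v` has degree ten; it kills the other lines because two lines share at most one
point. The signed complement of `S ∌ 1` contains `e₁`, so of `∂ (e₁ e_T)` it only sees `e_T`; when
`S` is a line, subtracting `dualLine` removes its pairing with `e_S`. -/
theorem dualCheck_osBasis : Poly.dualCheck osBasis osDual = true := by decide +kernel

/-- The span of the basis of `I₃`. -/
def osSpan : Submodule R (Ext R 9) :=
  Submodule.span R (Set.range fun i : Fin osBasis.length => Poly.eval R osBasis[i])

theorem eval_mem_osSpan {f : Poly} (hf : f ∈ osBasis) : Poly.eval R f ∈ osSpan R := by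
  obtain ⟨i, hi, rfl⟩ := List.getElem_of_mem hf
  exact Submodule.subset_span ⟨⟨i, hi⟩, rfl⟩

theorem lineWord_mem_osSpan {l : List ℕ} (hl : l ∈ lineWords) : word R l ∈ osSpan R := by
  rw [← Poly.eval_ofWord]
  exact eval_mem_osSpan R (List.mem_append_left _ (List.mem_map.2 ⟨l, hl, rfl⟩))

theorem differential_differential {n : ℕ} (a : Ext R n) :
    differential R n (differential R n a) = 0 :=
  CliffordAlgebra.contractLeft_contractLeft _ _

/-- Multiplication by `e₁` is a contracting homotopy: `∂ (e₁ ∂ a) = ∂ a`. Hence `∂ E₄ = ∂ (e₁ E₃)`,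
and words containing `e₁` drop out. -/
theorem differential_mem_osSpan {l : List ℕ} (hl : l.length = 4) :
    differential R 9 (word R l) ∈ osSpan R := by
  have h1 : differential R 9 (gen R (pt 1) * differential R 9 (word R l)) =
      differential R 9 (word R l) := by
    rw [differential_gen_mul, differential_differential, mul_zero, sub_zero]
  rw [← h1]
  have h3 : differential R 9 (word R l) ∈ ⋀[R]^3 (Fin 9 → R) := by
    have := differential_word_mem R l
    rwa [hl] at this
  have h4 := exteriorPower_le_span R 3 (by norm_num) h3
  generalize differential R 9 (word R l) = a at h4
  induction h4 using Submodule.span_induction with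
  | mem _ h =>
    obtain ⟨m, hm, rfl⟩ := h
    have key : ∀ m ∈ sortedWords 3, (insertGen 1 m).1 = 0 ∨ m ∈ labels.tail.sublistsLen 3 := by
      decide +kernel
    rcases key m hm with h | h
    · have h0 := insertGen_spec R 1 m
      rw [h, zero_smul] at h0
      rw [h0, map_zero]
      exact zero_mem _
    · rw [← word_cons, ← Poly.eval_ofWord, ← Poly.eval_deriv]
      exact eval_mem_osSpan R (List.mem_append_right _ (List.mem_map.2 ⟨m, h, rfl⟩))
  | zero => rw [mul_zero, map_zero]; exact zero_mem _
  | add _ _ _ _ h1 h2 => rw [mul_add, map_add]; exact add_mem h1 h2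
  | smul r _ _ h => rw [mul_smul_comm, map_smul]; exact Submodule.smul_mem _ _ h

theorem component_osIdeal_three_le : component R (osIdeal R hcv) 3 ≤ osSpan R := by
  refine component_span_le R ?_
  rintro _ ⟨S, hS, rfl⟩
  have h3 := three_le_card_of_dep hS
  refine ⟨S.card - 1, differential_mono_mem R S, fun l m hlm => ?_⟩
  by_cases h4 : S.card = 4
  · have hl : l = [] := List.length_eq_zero_iff.1 (by omega)
    have hm : m = [] := List.length_eq_zero_iff.1 (by omega)
    rw [hl, hm, word_nil, one_mul, mul_one, mono_eq_word]
    exact differential_mem_osSpan R (by rw [List.length_map, Finset.length_sort, h4])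
  · have hSL : S ∈ hcvLines := ((hcv_dep_iff S).1 hS).resolve_left (by omega)
    have hS3 := hcvLines_card S hSL
    obtain ⟨L, hL, rfl⟩ := exists_lineWord S hSL
    rw [mono_toFinset R (lineWord_pairwise L hL), mul_assoc,
      ← lineSpan_commute R (Submodule.subset_span ⟨L, hL, rfl⟩), ← mul_assoc, ← word_append]
    obtain ⟨k, hk⟩ := List.length_eq_one_iff.1 (show (l ++ m).length = 1 by
      rw [List.length_append]; omega)
    -- The Leibniz rule splits `e_k ∂ e_L` into `e_L` and a boundary from degree four.
    have h : gen R (pt k) * differential R 9 (word R L) =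
        word R L - differential R 9 (word R (k :: L)) := by
      rw [differential_word_cons, sub_sub_cancel]
    rw [hk, word_cons, word_nil, mul_one, h]
    exact sub_mem (lineWord_mem_osSpan R hL)
      (differential_mem_osSpan R (by rw [List.length_cons, lineWord_length L hL]))

theorem osSpan_le_component : osSpan R ≤ component R (osIdeal R hcv) 3 := by
  rw [osSpan, Submodule.span_le]
  rintro _ ⟨i, rfl⟩
  have hi : osBasis[i] ∈ osBasis := List.getElem_mem _
  simp only [SetLike.mem_coe]
  generalize osBasis[i] = f at hi
  rcases List.mem_append.1 hi with h | h
  · obtain ⟨l, hl, rfl⟩ := List.mem_map.1 h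
    rw [Poly.eval_ofWord, mem_component]
    refine ⟨?_, by simpa [lineWord_length l hl] using word_mem R l⟩
    -- Multiplying `∂ e_L` by the generator of the first point of `L` recovers `e_L`.
    have key : ∀ l ∈ lineWords, ((Poly.ofWord (l.take 1)).mul (Poly.ofWord l).deriv).equiv
        (Poly.ofWord l) = true := by
      decide +kernel
    have := Poly.eval_eq_of_equiv R (key l hl)
    rw [Poly.eval_mul, Poly.eval_deriv, Poly.eval_ofWord, Poly.eval_ofWord] at this
    rw [← this]
    exact TwoSidedIdeal.mul_mem_left _ _ _ (differential_lineWord_mem R hl)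
  · obtain ⟨l, hl, rfl⟩ := List.mem_map.1 h
    rw [Poly.eval_deriv, Poly.eval_ofWord, mem_component]
    have key : ∀ l ∈ labels.tail.sublistsLen 3, ((1 :: l).map pt).Pairwise (· < ·) := by
      decide +kernel
    have hlen := List.length_of_sublistsLen hl
    constructor
    · rw [← mono_toFinset R (key l hl)]
      refine differential_mono_mem_osIdeal R ((hcv_dep_iff _).2 (Or.inl ?_))
      rw [List.toFinset_card_of_nodup ((key l hl).imp ne_of_lt), List.length_map,
        List.length_cons, hlen]
      norm_num
    · simpa [hlen] using differential_word_mem R (1 :: l)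

theorem component_osIdeal_three : component R (osIdeal R hcv) 3 = osSpan R :=
  le_antisymm (component_osIdeal_three_le R) (osSpan_le_component R)

theorem osBasis_linearIndependent :
    LinearIndependent R fun i : Fin osBasis.length => Poly.eval R osBasis[i] :=
  linearIndependent_of_pairing R
    (Poly.pairing_of_dualCheck R dualCheck_osBasis (by simp [osBasis, osDual]))

theorem free_component_osIdeal : Module.Free R (component R (osIdeal R hcv) 3) := by
  rw [component_osIdeal_three]
  exact Module.Free.of_basis (Module.Basis.span (osBasis_linearIndependent R))

theorem rank_component_osIdeal [Nontrivial R] :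
    Module.rank R (component R (osIdeal R hcv) 3) = 65 := by
  rw [component_osIdeal_three, osSpan,
    rank_eq_card_basis (Module.Basis.span (osBasis_linearIndependent R)), Fintype.card_fin,
    show osBasis.length = 65 by decide +kernel]
  rfl

theorem not_isQuadratic [Nontrivial R] : ¬ IsQuadratic R hcv := by
  intro h
  have h1 := rank_component_truncIdeal_le R
  rw [show truncIdeal R 2 hcv = osIdeal R hcv from h, rank_component_osIdeal R] at h1
  exact absurd h1 (by norm_num)

/-! ### The elements `p` and `q` -/

namespace Poly

/-- The element `x`. -/
def xPoly : Poly :=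
  [(1, [1, 2, 3, 6, 8]), (-1, [1, 2, 4, 6, 9]), (1, [1, 2, 4, 8, 9]), (-1, [1, 2, 6, 8, 9]),
    (-1, [2, 3, 5, 6, 9])]

/-- The element `(1 + τ³ + τ⁶) x`. -/
def yPoly : Poly := xPoly ++ applyTau^[3] xPoly ++ applyTau^[6] xPoly

/-- The element `p`. -/
def pPoly : Poly := normalize (yPoly ++ smul (-1) (applyTau yPoly))

/-- The element `q`. -/
def qPoly : Poly := normalize (applyTau pPoly)

theorem eval_iterate_applyTau (n : ℕ) (f : Poly) :
    eval R (applyTau^[n] f) = (tauAlg R)^[n] (eval R f) := by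
  induction n with
  | zero => rfl
  | succ n ih => rw [Function.iterate_succ_apply', Function.iterate_succ_apply', eval_applyTau, ih]

theorem eval_xPoly : eval R xPoly = xElt R := by
  simp only [xPoly, eval_cons, eval_nil, xElt, one_smul, neg_smul]
  abel

theorem eval_yPoly : eval R yPoly = yElt R := by
  rw [yPoly, eval_append, eval_append, eval_iterate_applyTau, eval_iterate_applyTau, eval_xPoly,
    yElt]

theorem eval_pPoly : eval R pPoly = pElt R := by
  rw [pPoly, eval_normalize, eval_append, eval_smul, eval_applyTau, eval_yPoly, pElt,
    neg_one_smul, sub_eq_add_neg]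

theorem eval_qPoly : eval R qPoly = qElt R := by
  rw [qPoly, eval_normalize, eval_applyTau, eval_pPoly, qElt]

theorem eval_mem {n : ℕ} {f : Poly} (hf : ∀ t ∈ f, t.2.length = n) :
    eval R f ∈ ⋀[R]^n (Fin 9 → R) := by
  refine list_sum_mem fun x hx => ?_
  obtain ⟨t, ht, rfl⟩ := List.mem_map.1 hx
  refine zsmul_mem ?_ _
  have := word_mem R t.2
  rwa [hf t ht] at this

end Poly

theorem pElt_mem : pElt R ∈ ⋀[R]^5 (Fin 9 → R) := by
  rw [← Poly.eval_pPoly]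
  exact Poly.eval_mem R (by decide +kernel)

theorem qElt_mem : qElt R ∈ ⋀[R]^5 (Fin 9 → R) := by
  rw [← Poly.eval_qPoly]
  exact Poly.eval_mem R (by decide +kernel)

/-- Since the generators of `J` are central, annihilating the nine `∂ e_L` is enough to annihilate
`J`. -/
theorem mul_eq_zero_of_mem_truncIdeal {a : Ext R 9}
    (h : ∀ l ∈ lineWords, a * differential R 9 (word R l) = 0) {b : Ext R 9}
    (hb : b ∈ truncIdeal R 2 hcv) : a * b = 0 := by
  have hmem : b ∈ LinearMap.ker (LinearMap.mulLeft R a) := by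
    refine mem_of_mem_span R ?_ hb
    rintro g ⟨r, hr, hg⟩ l m
    have hg' := component_osIdeal_le_of_le_two R hr hg
    have hag : a * g = 0 := by
      clear hg
      induction hg' using Submodule.span_induction with
      | mem _ h' => obtain ⟨l, hl, rfl⟩ := h'; exact h l hl
      | zero => rw [mul_zero]
      | add _ _ _ _ h1 h2 => rw [mul_add, h1, h2, add_zero]
      | smul r _ _ h => rw [mul_smul_comm, h, smul_zero]
    rw [LinearMap.mem_ker, LinearMap.mulLeft_apply, lineSpan_commute R hg', ← mul_assoc,
      ← mul_assoc, hag, zero_mul, zero_mul]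
  simpa using hmem

theorem mem_annihilator_iff {a : Ext R 9} : a ∈ annihilator R (truncIdeal R 2 hcv) ↔
    ∀ l ∈ lineWords, a * differential R 9 (word R l) = 0 := by
  rw [mem_annihilator]
  exact ⟨fun h l hl => h _ (differential_lineWord_mem_trunc R hl),
    fun h b hb => mul_eq_zero_of_mem_truncIdeal R h hb⟩

theorem pElt_mem_annihilator : pElt R ∈ annihilator R (truncIdeal R 2 hcv) := by
  refine (mem_annihilator_iff R).2 fun l hl => ?_
  have key : ∀ l ∈ lineWords, (Poly.pPoly.mul (Poly.ofWord l).deriv).isZero = true := by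
    decide +kernel
  have := Poly.eval_eq_zero R (key l hl)
  rwa [Poly.eval_mul, Poly.eval_deriv, Poly.eval_ofWord, Poly.eval_pPoly] at this

theorem qElt_mem_annihilator : qElt R ∈ annihilator R (truncIdeal R 2 hcv) := by
  refine (mem_annihilator_iff R).2 fun l hl => ?_
  have key : ∀ l ∈ lineWords, (Poly.qPoly.mul (Poly.ofWord l).deriv).isZero = true := by
    decide +kernel
  have := Poly.eval_eq_zero R (key l hl)
  rwa [Poly.eval_mul, Poly.eval_deriv, Poly.eval_ofWord, Poly.eval_qPoly] at this

theorem pElt_mul_word_one : pElt R * word R [1, 2, 3, 6] = 0 := by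
  rw [← Poly.eval_pPoly, ← Poly.eval_ofWord, ← Poly.eval_mul]
  exact Poly.eval_eq_zero R (by decide +kernel)

theorem qElt_mul_word_one : qElt R * word R [1, 2, 3, 6] = -topElt R := by
  rw [← Poly.eval_qPoly, ← Poly.eval_ofWord, ← Poly.eval_mul,
    Poly.eval_eq_of_equiv R (g := Poly.smul (-1) (Poly.ofWord labels)) (by decide +kernel),
    Poly.eval_smul, Poly.eval_ofWord, neg_one_smul, topElt]

theorem pElt_mul_word_two : pElt R * word R [1, 2, 3, 8] = topElt R := by
  rw [← Poly.eval_pPoly, ← Poly.eval_ofWord, ← Poly.eval_mul,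
    Poly.eval_eq_of_equiv R (g := Poly.ofWord labels) (by decide +kernel),
    Poly.eval_ofWord, topElt]

theorem qElt_mul_word_two : qElt R * word R [1, 2, 3, 8] = -topElt R := by
  rw [← Poly.eval_qPoly, ← Poly.eval_ofWord, ← Poly.eval_mul,
    Poly.eval_eq_of_equiv R (g := Poly.smul (-1) (Poly.ofWord labels)) (by decide +kernel),
    Poly.eval_smul, Poly.eval_ofWord, neg_one_smul, topElt]

theorem eq_zero_of_smul_add_smul_eq_zero {α β : R} (h : α • pElt R + β • qElt R = 0) :
    α = 0 ∧ β = 0 := by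
  have h1 := congrArg (· * word R [1, 2, 3, 6]) h
  have h2 := congrArg (· * word R [1, 2, 3, 8]) h
  simp only [add_mul, smul_mul_assoc, zero_mul, pElt_mul_word_one, qElt_mul_word_one,
    pElt_mul_word_two, qElt_mul_word_two, smul_zero, zero_add, smul_neg, neg_eq_zero] at h1 h2
  have hβ := smul_topElt_injective R h1
  rw [hβ, zero_smul, neg_zero, add_zero] at h2
  exact ⟨smul_topElt_injective R h2, hβ⟩

theorem linearIndependent_pElt_qElt : LinearIndependent R ![pElt R, qElt R] :=
  LinearIndependent.pair_iff.2 fun _ _ h => eq_zero_of_smul_add_smul_eq_zero R h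

/-! ### Percolation modulo a submodule

If a submodule contains a combination of words and all of these words but one, which has an
invertible coefficient, then it contains the remaining word. -/

namespace Poly

/-- The word `l` has an invertible coefficient in `f`, and all other words of `f` belong to `K`. -/
def derives (l : List ℕ) (K : List (List ℕ)) (f : Poly) : Bool :=
  (f.any fun t => decide (t.2 = l)) && match f.filter fun t => !K.contains t.2 with
    | [(c, m)] => decide (m = l) && decide (c * c = 1)
    | _ => false

/-- Every word of the list belongs to `B` or is obtained, by one of the combinations in `rel`, from
the words to its right. -/
def percolates (rel : List Poly) (B : List (List ℕ)) : List (List ℕ) → Bool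
  | [] => true
  | l :: K => (B.contains l || rel.any (derives l K)) && percolates rel B K

variable {R} {N : Submodule R (Ext R 9)}

theorem word_mem_of_derives {f : Poly} (hf : eval R f ∈ N) {K : List (List ℕ)}
    (hK : ∀ l ∈ K, word R l ∈ N) {l : List ℕ} (h : derives l K f = true) : word R l ∈ N := by
  have hsum : ∀ g : Poly, eval R g - eval R (g.filter fun t => !K.contains t.2) ∈ N := by
    intro g
    induction g with
    | nil => simp
    | cons t g ih =>
      by_cases ht : t.2 ∈ K
      · rw [List.filter_cons_of_neg (by simpa using ht), eval_cons, add_sub_assoc]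
        exact add_mem (zsmul_mem (hK _ ht) _) ih
      · rw [List.filter_cons_of_pos (by simpa using ht), eval_cons, eval_cons,
          add_sub_add_left_eq_sub]
        exact ih
  rw [derives, Bool.and_eq_true] at h
  -- The first conjunct of `derives` is only a quick filter for the search; soundness rests on the
  -- second.
  replace h := h.2
  split at h
  · rename_i c m hm
    simp only [Bool.and_eq_true, decide_eq_true_eq] at h
    obtain ⟨rfl, hc⟩ := h
    have h1 := hsum f
    rw [hm, eval_cons, eval_nil, add_zero] at h1
    -- The coefficient satisfies `c * c = 1`, so it is its own inverse.
    have h2 := zsmul_mem (sub_mem hf h1) c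
    simpa only [sub_sub_cancel, ← mul_smul, hc, one_smul] using h2
  · simp at h

theorem word_mem_of_percolates {rel : List Poly} (hrel : ∀ f ∈ rel, eval R f ∈ N)
    {B : List (List ℕ)} (hB : ∀ l ∈ B, word R l ∈ N) {K : List (List ℕ)}
    (h : percolates rel B K = true) : ∀ l ∈ K, word R l ∈ N := by
  induction K with
  | nil => simp
  | cons l K ih =>
    simp only [percolates, Bool.and_eq_true, Bool.or_eq_true, List.contains_iff_mem,
      List.any_eq_true] at h
    have hK := ih h.2
    rintro m hm
    rcases List.mem_cons.1 hm with rfl | hm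
    · rcases h.1 with h1 | ⟨f, hf, h1⟩
      · exact hB _ h1
      · exact word_mem_of_derives (hrel f hf) hK h1
    · exact hK m hm

end Poly

/-! ### The degree five component of the annihilator -/

/-- The elements `e_i e_j ∂ e_L`. -/
def quarticRelations : List Poly :=
  lineWords.flatMap fun l => (sortedWords 2).map fun m =>
    Poly.normalize ((Poly.ofWord m).mul (Poly.ofWord l).deriv)

/-- The increasing words of length four that contain no line, in an order in which they can be
obtained one by one from the last two. -/
def percolationOrder : List (List ℕ) :=
  [[5, 6, 7, 9], [4, 5, 7, 9], [1, 4, 8, 9], [1, 5, 8, 9], [1, 5, 6, 7], [1, 4, 5, 7], [1, 2, 3, 7],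
    [4, 7, 8, 9], [1, 4, 7, 8], [1, 2, 4, 7], [3, 4, 5, 7], [2, 4, 8, 9], [2, 4, 5, 6],
    [3, 5, 6, 7], [4, 6, 8, 9], [1, 3, 8, 9], [1, 3, 7, 8], [3, 5, 7, 8], [4, 5, 6, 9],
    [2, 3, 5, 7], [2, 4, 5, 9], [5, 7, 8, 9], [2, 5, 6, 7], [3, 7, 8, 9], [1, 6, 7, 8],
    [2, 5, 8, 9], [2, 3, 7, 9], [2, 3, 4, 9], [1, 6, 8, 9], [1, 2, 4, 9], [3, 6, 7, 9],
    [3, 4, 6, 9], [1, 2, 4, 6], [2, 5, 6, 8], [2, 3, 4, 7], [5, 6, 7, 8], [2, 3, 5, 8],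
    [1, 4, 5, 6], [3, 4, 7, 8], [3, 4, 5, 6], [2, 3, 4, 6], [1, 5, 6, 8], [1, 2, 6, 8],
    [5, 6, 8, 9], [3, 4, 8, 9], [1, 3, 5, 6], [2, 4, 6, 8], [2, 4, 5, 7], [2, 3, 6, 7],
    [6, 7, 8, 9], [2, 4, 7, 9], [2, 3, 8, 9], [2, 3, 5, 6], [1, 3, 6, 9], [1, 4, 6, 9],
    [1, 3, 5, 7], [1, 2, 8, 9], [1, 2, 6, 7], [3, 4, 7, 9], [1, 4, 6, 8], [1, 3, 6, 7],
    [1, 4, 5, 9], [1, 3, 5, 8], [2, 3, 4, 8], [2, 5, 7, 9], [1, 5, 7, 8], [1, 5, 6, 9],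
    [1, 2, 4, 8], [1, 2, 3, 9], [2, 3, 4, 5], [1, 2, 3, 8], [1, 2, 3, 6]]

/-- The increasing words of length four that contain a line. -/
def wordsWithLine : List (List ℕ) :=
  (sortedWords 4).filter fun l => lineWords.any fun L => L.all fun k => l.contains k

/-- The list is filled from its right end. A word containing a line is itself, up to sign, a
relation `e_i e_j ∂ e_L` with `i ∈ L`. For `i, j ∉ L` the relation has three words, and two known
ones yield the third. -/
theorem percolates_quarticRelations : Poly.percolates quarticRelations
    [[1, 2, 3, 6], [1, 2, 3, 8]] (percolationOrder ++ wordsWithLine) = true := by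
  decide +kernel

theorem sortedWords_four_subset : ∀ l ∈ sortedWords 4, l ∈ percolationOrder ++ wordsWithLine := by
  decide +kernel

/-- The kernel of multiplication by `a` contains the quartic relations and the two initial words,
hence by percolation all words of length four; the perfect pairing concludes. -/
theorem eq_zero_of_mem_component_annihilator {a : Ext R 9}
    (ha : a ∈ component R (annihilator R (truncIdeal R 2 hcv)) 5)
    (h1 : a * word R [1, 2, 3, 6] = 0) (h2 : a * word R [1, 2, 3, 8] = 0) : a = 0 := by
  rw [mem_component] at ha
  refine eq_zero_of_mul_word_eq_zero R ha.2 fun l hl => ?_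
  have hrel : ∀ f ∈ quarticRelations, Poly.eval R f ∈ LinearMap.ker (LinearMap.mulLeft R a) := by
    intro f hf
    obtain ⟨l, hl, hf⟩ := List.mem_flatMap.1 hf
    obtain ⟨m, -, rfl⟩ := List.mem_map.1 hf
    rw [Poly.eval_normalize, Poly.eval_mul, Poly.eval_deriv, Poly.eval_ofWord, Poly.eval_ofWord,
      LinearMap.mem_ker, LinearMap.mulLeft_apply]
    exact (mem_annihilator R _ a).1 ha.1 _
      (TwoSidedIdeal.mul_mem_left _ _ _ (differential_lineWord_mem_trunc R hl))
  have hK : ∀ l ∈ [[1, 2, 3, 6], [1, 2, 3, 8]],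
      word R l ∈ LinearMap.ker (LinearMap.mulLeft R a) := by
    simp [h1, h2]
  simpa using Poly.word_mem_of_percolates hrel hK percolates_quarticRelations l
    (sortedWords_four_subset l hl)

theorem smul_add_smul_mem_component (α β : R) : α • pElt R + β • qElt R ∈
    component R (annihilator R (truncIdeal R 2 hcv)) 5 :=
  add_mem
    (Submodule.smul_mem _ _ ((mem_component R).2 ⟨pElt_mem_annihilator R, pElt_mem R⟩))
    (Submodule.smul_mem _ _ ((mem_component R).2 ⟨qElt_mem_annihilator R, qElt_mem R⟩))

theorem exists_eq_smul_add_smul {a : Ext R 9}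
    (ha : a ∈ component R (annihilator R (truncIdeal R 2 hcv)) 5) :
    ∃ α β : R, a = α • pElt R + β • qElt R := by
  have h9 : ∀ l : List ℕ, l.length = 4 → ∃ r : R, a * word R l = r • topElt R := by
    intro l hl
    refine exists_eq_smul_topElt R ?_
    have := word_mem R l
    rw [hl] at this
    exact SetLike.mul_mem_graded (A := fun i : ℕ => ⋀[R]^i (Fin 9 → R)) ha.2 this
  obtain ⟨r, hr⟩ := h9 [1, 2, 3, 6] rfl
  obtain ⟨s, hs⟩ := h9 [1, 2, 3, 8] rfl
  -- On the two words `α p + β q` takes the values `-β` and `α - β`, which have to equal `r` and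
  -- `s`.
  refine ⟨s - r, -r, ?_⟩
  rw [← sub_eq_zero]
  refine eq_zero_of_mem_component_annihilator R
    (sub_mem ha (smul_add_smul_mem_component R _ _)) ?_ ?_
  · simp only [sub_mul, add_mul, smul_mul_assoc, pElt_mul_word_one, qElt_mul_word_one, hr]
    module
  · simp only [sub_mul, add_mul, smul_mul_assoc, pElt_mul_word_two, qElt_mul_word_two, hs]
    module

theorem span_pElt_qElt : Submodule.span R {pElt R, qElt R} =
    component R (annihilator R (truncIdeal R 2 hcv)) 5 := by
  ext a
  rw [Submodule.mem_span_pair]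
  constructor
  · rintro ⟨α, β, rfl⟩
    exact smul_add_smul_mem_component R α β
  · intro ha
    obtain ⟨α, β, h⟩ := exists_eq_smul_add_smul R ha
    exact ⟨α, β, h.symm⟩

/-! ### Pure elements -/

theorem prod_map_ι_mem (l : List (Fin 9 → R)) :
    (l.map (ι R)).prod ∈ ⋀[R]^l.length (Fin 9 → R) := by
  induction l with
  | nil => exact Submodule.one_le.1 (by simp)
  | cons v l ih =>
    rw [List.map_cons, List.prod_cons, List.length_cons, exteriorPower, pow_succ']
    exact Submodule.mul_mem_mul ⟨_, rfl⟩ ih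

theorem isPure_word (l : List ℕ) : IsPure R (word R l) :=
  ⟨l.map fun k => Pi.single (pt k) 1, by rw [word, List.map_map]; rfl⟩

theorem IsPure.mul {n : ℕ} {a b : Ext R n} (ha : IsPure R a) (hb : IsPure R b) :
    IsPure R (a * b) := by
  obtain ⟨l, rfl⟩ := ha
  obtain ⟨m, rfl⟩ := hb
  exact ⟨l ++ m, by rw [List.map_append, List.prod_append]⟩

/-- By the Leibniz rule a contraction removes one factor from a product of vectors of `V` and leaves
the others in `V`. -/
theorem contraction_mem_pow (V : Submodule R (Fin 9 → R)) (d : Module.Dual R (Fin 9 → R)) (m : ℕ)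
    {a : Ext R 9} (ha : a ∈ V.map (ι R) ^ (m + 1)) : contraction R d a ∈ V.map (ι R) ^ m := by
  induction m generalizing a with
  | zero =>
    rw [zero_add, pow_one] at ha
    obtain ⟨v, -, rfl⟩ := ha
    have := contraction_ι_mul R d v 1
    rw [mul_one, contraction_one, mul_zero, sub_zero] at this
    rw [this, pow_zero]
    exact Submodule.smul_mem _ _ (Submodule.one_le.1 le_rfl)
  | succ m ih =>
    rw [pow_succ'] at ha
    refine Submodule.mul_induction_on ha ?_ fun x y hx hy => by rw [map_add]; exact add_mem hx hy
    rintro _ ⟨v, hv, rfl⟩ b hb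
    rw [contraction_ι_mul]
    refine sub_mem (Submodule.smul_mem _ _ hb) ?_
    rw [pow_succ']
    exact Submodule.mul_mem_mul ⟨v, hv, rfl⟩ (ih hb)

theorem mul_prod_map_ι_eq_zero (l : List (Fin 9 → R)) {a : Ext R 9}
    (ha : a ∈ (Submodule.span R {v | v ∈ l}).map (ι R)) : a * (l.map (ι R)).prod = 0 := by
  obtain ⟨v, hv, rfl⟩ := ha
  induction hv using Submodule.span_induction with
  | mem v hv =>
    obtain ⟨i, hi, rfl⟩ := List.getElem_of_mem hv
    have := ι_mul_prod_list (R := R) (fun i : Fin l.length => l[i]) ⟨i, hi⟩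
    have h : (List.ofFn fun i : Fin l.length => ι R l[i]) = l.map (ι R) := by
      apply List.ext_getElem <;> simp
    rwa [h] at this
  | zero => rw [map_zero, zero_mul]
  | add _ _ _ _ h1 h2 => rw [map_add, add_mul, h1, h2, add_zero]
  | smul r _ _ h => rw [map_smul, smul_mul_assoc, h, smul_zero]

/-- The iterated contraction with the coordinate forms given by a word. -/
def contractions (l : List ℕ) : Ext R 9 →ₗ[R] Ext R 9 :=
  l.foldr (fun k f => contraction R (LinearMap.proj (pt k)) ∘ₗ f) LinearMap.id

/-- The Plücker relations: all contractions of degree one of a pure element annihilate it. -/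
theorem contractions_mul_eq_zero {l : List (Fin 9 → R)} {w : List ℕ}
    (h : l.length = w.length + 1) :
    contractions R w (l.map (ι R)).prod * (l.map (ι R)).prod = 0 := by
  refine mul_prod_map_ι_eq_zero R l ?_
  set V := Submodule.span R {v | v ∈ l} with hV
  have h1 : (l.map (ι R)).prod ∈ V.map (ι R) ^ l.length := by
    have : ∀ l' : List (Fin 9 → R), (∀ v ∈ l', v ∈ V) →
        (l'.map (ι R)).prod ∈ V.map (ι R) ^ l'.length := by
      intro l' hl'
      induction l' with
      | nil => exact Submodule.one_le.1 (by simp)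
      | cons v l' ih =>
        rw [List.map_cons, List.prod_cons, List.length_cons, pow_succ']
        exact Submodule.mul_mem_mul ⟨v, hl' v (by simp), rfl⟩ (ih fun u hu => hl' u (by simp [hu]))
    exact this l fun v hv => Submodule.subset_span hv
  -- Each contraction lowers the exponent by one; with one more factor than contractions, a vector
  -- of `V` remains.
  have h2 : ∀ (w : List ℕ) (m : ℕ) {a : Ext R 9}, a ∈ V.map (ι R) ^ (w.length + m) →
      contractions R w a ∈ V.map (ι R) ^ m := by
    intro w
    induction w with
    | nil => intro m a ha; simpa [contractions] using ha
    | cons k w ih =>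
      intro m a ha
      refine contraction_mem_pow R V _ m (ih (m + 1) ?_)
      rwa [List.length_cons, add_right_comm, add_assoc] at ha
  rw [h] at h1
  simpa using h2 w 1 h1

namespace Poly

/-- The iterated contraction with the coordinate forms given by a word. -/
def coordContracts (l : List ℕ) (f : Poly) : Poly := l.foldr coordContract f

theorem eval_coordContracts (l : List ℕ) (f : Poly) :
    eval R (coordContracts l f) = contractions R l (eval R f) := by
  induction l with
  | nil => rfl
  | cons k l ih =>
    rw [coordContracts, List.foldr_cons, eval_coordContract]
    exact congrArg _ ih

end Poly

/-- The quadratic form in `α, β` given by a coefficient of a Plücker relation of `α p + β q`. -/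
theorem quadratic_eq_zero {α β : R} {w m : List ℕ} {A B C : ℤ} (hw : w.length = 4)
    (hA : ((Poly.coordContracts w Poly.pPoly).mul (Poly.pPoly.mul (Poly.ofWord m))).equiv
      (Poly.smul A (Poly.ofWord labels)) = true)
    (hB : ((Poly.coordContracts w Poly.pPoly).mul (Poly.qPoly.mul (Poly.ofWord m)) ++
      (Poly.coordContracts w Poly.qPoly).mul (Poly.pPoly.mul (Poly.ofWord m))).equiv
      (Poly.smul B (Poly.ofWord labels)) = true)
    (hC : ((Poly.coordContracts w Poly.qPoly).mul (Poly.qPoly.mul (Poly.ofWord m))).equiv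
      (Poly.smul C (Poly.ofWord labels)) = true)
    {l : List (Fin 9 → R)} (hl : l.length = 5)
    (h : α • pElt R + β • qElt R = (l.map (ι R)).prod) :
    A * α ^ 2 + B * (α * β) + C * β ^ 2 = 0 := by
  have h0 := contractions_mul_eq_zero R (l := l) (w := w) (by rw [hl, hw])
  rw [← h] at h0
  -- The Plücker relation has degree `1 + 5`; a word `m` of length three reads off one of its
  -- coefficients in the top degree.
  have h1 := congrArg (· * word R m) h0
  have hA' := Poly.eval_eq_of_equiv R hA
  have hB' := Poly.eval_eq_of_equiv R hB
  have hC' := Poly.eval_eq_of_equiv R hC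
  simp only [Poly.eval_append, Poly.eval_mul, Poly.eval_coordContracts, Poly.eval_pPoly,
    Poly.eval_qPoly, Poly.eval_ofWord, Poly.eval_smul] at hA' hB' hC'
  refine smul_topElt_injective R ?_
  have h2 : (A * α ^ 2 + B * (α * β) + C * β ^ 2 : R) • topElt R =
      α ^ 2 • (A • topElt R) + (α * β) • (B • topElt R) + β ^ 2 • (C • topElt R) := by
    simp only [← Int.cast_smul_eq_zsmul R, ← mul_smul, ← add_smul]
    congr 1
    ring
  rw [h2, topElt, ← hA', ← hB', ← hC', ← zero_mul (word R m), ← h0]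
  simp only [map_add, map_smul, add_mul, mul_add, smul_add, smul_mul_assoc, mul_smul_comm,
    mul_assoc, smul_smul]
  rw [pow_two, pow_two, mul_comm β α]
  abel

theorem eq_zero_of_isPure [IsReduced R] {a : Ext R 9}
    (ha : a ∈ component R (annihilator R (truncIdeal R 2 hcv)) 5) (hp : IsPure R a) : a = 0 := by
  obtain ⟨l, rfl⟩ := hp
  by_cases hl : l.length = 5
  · obtain ⟨α, β, h⟩ := exists_eq_smul_add_smul R ha
    -- These two choices of `w` and `m` isolate `-α²` and `-β²`; reducedness then suffices.
    have h1 := quadratic_eq_zero R (w := [1, 2, 3, 6]) (m := [1, 6, 9]) (A := -1) (B := 0) (C := 0)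
      rfl (by decide +kernel) (by decide +kernel) (by decide +kernel) hl h.symm
    have h2 := quadratic_eq_zero R (w := [1, 2, 3, 5]) (m := [3, 8, 9]) (A := 0) (B := 0) (C := -1)
      rfl (by decide +kernel) (by decide +kernel) (by decide +kernel) hl h.symm
    have hα : α = 0 := by
      rw [← pow_eq_zero_iff (two_ne_zero)]; simpa using h1
    have hβ : β = 0 := by
      rw [← pow_eq_zero_iff (two_ne_zero)]; simpa using h2
    rw [h, hα, hβ, zero_smul, zero_smul, add_zero]
  · exact eq_zero_of_mem_of_mem R hl (prod_map_ι_mem R l) ha.2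

/-- Multiplying a pure generator by words keeps it pure. If pure elements generated `J⁰`, its degree
five component would be spanned by pure elements of that component, all zero, whereas `p ≠ 0`. -/
theorem not_isPureIdeal [IsReduced R] [Nontrivial R] :
    ¬ IsPureIdeal R (annihilator R (truncIdeal R 2 hcv)) := by
  rintro ⟨S, hS, hI⟩
  have hle : component R (TwoSidedIdeal.span S) 5 ≤ ⊥ := by
    refine component_span_le R fun s hs => ?_
    obtain ⟨l, rfl⟩ := hS s hs
    refine ⟨l.length, prod_map_ι_mem R l, fun w w' hlen => ?_⟩
    rw [Submodule.mem_bot]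
    refine eq_zero_of_isPure R ((mem_component R).2 ⟨?_, ?_⟩)
      (((isPure_word R w).mul R (hS _ hs)).mul R (isPure_word R w'))
    · rw [hI]
      exact TwoSidedIdeal.mul_mem_right _ _ _
        (TwoSidedIdeal.mul_mem_left _ _ _ (TwoSidedIdeal.subset_span hs))
    · rw [← hlen]
      exact SetLike.mul_mem_graded (A := fun i : ℕ => ⋀[R]^i (Fin 9 → R))
        (SetLike.mul_mem_graded (A := fun i : ℕ => ⋀[R]^i (Fin 9 → R)) (word_mem R w)
          (prod_map_ι_mem R l)) (word_mem R w')
  rw [← hI] at hle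
  have hp : pElt R = 0 := hle ((mem_component R).2 ⟨pElt_mem_annihilator R, pElt_mem R⟩)
  have := eq_zero_of_smul_add_smul_eq_zero R (α := 1) (β := 0) (by rw [hp]; simp)
  exact one_ne_zero this.1

/-! ### The matroid -/

theorem hcv_eRank : hcv.eRank = 3 := by
  obtain ⟨B, hB⟩ := hcv.exists_isBase
  have hfin : B.Finite := Set.toFinite B
  refine le_antisymm ?_ ?_
  · rw [← hB.encard_eq_eRank]
    have := ((hcv_indep_iff hfin.toFinset).1 (by simpa using hB.indep)).1
    rw [hfin.encard_eq_coe_toFinset_card]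
    exact_mod_cast this
  · have h : hcv.Indep (({pt 1, pt 2, pt 3} : Finset (Fin 9)) : Set (Fin 9)) :=
      (hcv_indep_iff _).2 (by decide)
    have := h.encard_le_eRank
    rwa [Set.encard_coe_eq_coe_finsetCard, show ({pt 1, pt 2, pt 3} : Finset (Fin 9)).card = 3 by
      decide] at this

/-- The three colours are not pairwise distinct. -/
abbrev NotRainbow (a b c : Fin 4) : Prop := a = b ∨ a = c ∨ b = c

set_option synthInstance.maxSize 10000 in
set_option synthInstance.maxHeartbeats 2000000 in
/-- A colouring of the points by four colours without rainbow line does not use all colours. -/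
theorem colouring_not_surjective : ∀ c1 c2 c5 : Fin 4, NotRainbow c1 c2 c5 →
    ∀ c3 c4, NotRainbow c1 c3 c4 → ∀ c8, NotRainbow c4 c5 c8 →
    ∀ c9, NotRainbow c3 c5 c9 → ∀ c6, NotRainbow c2 c6 c9 → NotRainbow c3 c6 c8 →
    ∀ c7, NotRainbow c1 c7 c9 → NotRainbow c2 c7 c8 → NotRainbow c4 c6 c7 →
    ∃ d, c1 ≠ d ∧ c2 ≠ d ∧ c3 ≠ d ∧ c4 ≠ d ∧ c5 ≠ d ∧ c6 ≠ d ∧ c7 ≠ d ∧ c8 ≠ d ∧ c9 ≠ d := by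
  -- The line conditions are interleaved with the colours, so that the exhaustive search is cut off
  -- as soon as a line is rainbow.
  decide +kernel

theorem exists_rainbow_line {c : Fin 9 → Fin 4} (hc : Function.Surjective c) :
    ∃ L ∈ hcvLines, Set.InjOn c L := by
  by_contra! h
  have hL : ∀ i j k : Fin 9, ({i, j, k} : Finset (Fin 9)) ∈ hcvLines →
      NotRainbow (c i) (c j) (c k) := by
    intro i j k hijk
    by_contra hn
    simp only [NotRainbow, not_or] at hn
    refine h _ hijk ?_
    intro x hx y hy hxy
    simp only [Finset.coe_insert, Finset.coe_singleton, Set.mem_insert_iff,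
      Set.mem_singleton_iff] at hx hy
    rcases hx with rfl | rfl | rfl <;> rcases hy with rfl | rfl | rfl <;> grind
  obtain ⟨d, hd⟩ := colouring_not_surjective (c (pt 1)) (c (pt 2)) (c (pt 5))
    (hL _ _ _ (by simp [hcvLines])) (c (pt 3)) (c (pt 4)) (hL _ _ _ (by simp [hcvLines]))
    (c (pt 8)) (hL _ _ _ (by simp [hcvLines])) (c (pt 9)) (hL _ _ _ (by simp [hcvLines]))
    (c (pt 6)) (hL _ _ _ (by simp [hcvLines])) (hL _ _ _ (by simp [hcvLines]))
    (c (pt 7)) (hL _ _ _ (by simp [hcvLines])) (hL _ _ _ (by simp [hcvLines]))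
    (hL _ _ _ (by simp [hcvLines]))
  obtain ⟨i, hi⟩ := hc d
  have hpts : ∀ i : Fin 9, i = pt 1 ∨ i = pt 2 ∨ i = pt 3 ∨ i = pt 4 ∨ i = pt 5 ∨ i = pt 6 ∨
      i = pt 7 ∨ i = pt 8 ∨ i = pt 9 := by
    decide
  obtain ⟨h1, h2, h3, h4, h5, h6, h7, h8, h9⟩ := hd
  rcases hpts i with rfl | rfl | rfl | rfl | rfl | rfl | rfl | rfl | rfl <;> contradiction

/-- As the rank is three, only choices from four parts go beyond the hypothesis. Four parts cannot
occur: a rainbow line for the induced colouring would be a dependent choice from three parts. -/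
theorem matroidIndep_hcv : MatroidIndep hcv 3 := by
  classical
  intro π hπ 𝒜 h𝒜 hcard
  rw [hcv_eRank] at hcard
  have hcard4 : 𝒜.card ≤ 4 := by
    have : (𝒜.card : ℕ∞) ≤ (4 : ℕ) := hcard.trans (by norm_num)
    exact_mod_cast this
  by_cases h3 : 𝒜.card ≤ 3
  · exact hπ 𝒜 h𝒜 (by exact_mod_cast h3)
  exfalso
  have h4 : 𝒜.card = 4 := by omega
  let e : 𝒜 ≃ Fin 4 := 𝒜.equivFinOfCardEq h4
  -- All remaining parts are given colour `0`. This is harmless: points of different colours still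
  -- lie in different parts.
  let c : Fin 9 → Fin 4 := fun i => if h : π.part i ∈ 𝒜 then e ⟨_, h⟩ else 0
  have hsurj : Function.Surjective c := by
    intro d
    obtain ⟨A, hA⟩ := e.surjective d
    obtain ⟨i, hi⟩ := π.nonempty_of_mem_parts (h𝒜 A.2)
    have hpart : π.part i = A := π.part_eq_of_mem (h𝒜 A.2) hi
    refine ⟨i, ?_⟩
    simp only [c, hpart, A.2, dif_pos]
    exact hA
  obtain ⟨L, hL, hinj⟩ := exists_rainbow_line hsurj
  have hinj' : Set.InjOn π.part L := by
    intro x hx y hy hxy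
    refine hinj hx hy ?_
    simp only [c, hxy]
  have hinv : ∀ x ∈ L, Function.invFunOn π.part L (π.part x) = x := fun x hx =>
    hinj'.leftInvOn_invFunOn hx
  -- The parts met by `L` are represented by the points of `L` themselves, so `3`-independence would
  -- make the line independent.
  have hind := hπ (L.image π.part)
    (fun A hA => by
      obtain ⟨x, -, rfl⟩ := Finset.mem_image.1 hA
      exact π.part_mem.2 (Finset.mem_univ _))
    (by
      have : (L.image π.part).card ≤ 3 := Finset.card_image_le.trans (hcvLines_card L hL).le
      exact_mod_cast this)
    (Function.invFunOn π.part L)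
    (fun A hA => by
      obtain ⟨x, hx, rfl⟩ := Finset.mem_image.1 hA
      rw [hinv x hx]
      exact π.mem_part (Finset.mem_univ _))
  have himage : Function.invFunOn π.part L '' (L.image π.part : Finset (Finset (Fin 9))) = L := by
    ext x
    simp only [Finset.coe_image, Set.mem_image, Finset.mem_coe, exists_exists_and_eq_and]
    exact ⟨fun ⟨y, hy, hyx⟩ => by rw [← hyx, hinv y hy]; exact hy, fun hx => ⟨x, hx, hinv x hx⟩⟩
  rw [himage] at hind
  exact ((hcv_indep_iff L).1 hind).2 hL

end OrlikSolomon

theorem mainTheorem6 (R : Type*) [CommRing R] [Nontrivial R] :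
    hcv.eRank = 3 ∧
    MatroidIndep hcv 3 ∧
    ¬ IsQuadratic R hcv ∧
    Module.rank R (component R (truncIdeal R 2 hcv) 3) ≤ 63 ∧
    Module.Free R (component R (osIdeal R hcv) 3) ∧
    Module.rank R (component R (osIdeal R hcv) 3) = 65 ∧
    LinearIndependent R ![pElt R, qElt R] ∧
    Submodule.span R {pElt R, qElt R} =
      component R (annihilator R (truncIdeal R 2 hcv)) 5 ∧
    (IsDomain R →
      (∀ a ∈ component R (annihilator R (truncIdeal R 2 hcv)) 5, IsPure R a → a = 0) ∧
      ¬ IsPureIdeal R (annihilator R (truncIdeal R 2 hcv))) :=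
  ⟨hcv_eRank, matroidIndep_hcv, not_isQuadratic R, rank_component_truncIdeal_le R,
    free_component_osIdeal R, rank_component_osIdeal R, linearIndependent_pElt_qElt R,
    span_pElt_qElt R, fun _ => ⟨fun _ ha hp => eq_zero_of_isPure R ha hp, not_isPureIdeal R⟩⟩
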